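/- Let $k$ be an algebraically closed field and $d\ge 1$ an integer. Let $\mathcal{Q}_d\simeq\mathbb{A}^d$ be the $k$-scheme of monic polynomials of degree $d$ in $t$, $A_d\simeq\mathbb{A}^d$ the $k$-scheme of polynomials in $t$ of degree at most $d-1$, $\mathcal{L}\mathbb{A}^1=\operatorname{Spec}k[x_0,x_1,\dots]$ the arc space of the affine line (with $R$-points $R[[t]]$ for every $k$-algebra $R$) and $\mathcal{L}\mathbb{G}_m=\operatorname{Spec}k[x_0,x_0^{-1},x_1,\dots]$ the arc space of $\mathbb{G}_m$ (with $R$-points $R[[t]]^\times$). Let $\mathcal{L}\mathbb{A}^{\le d}\subset\mathcal{L}\mathbb{A}^1$ be the open subscheme of arcs of valuation at most $d$, that is, the inverse image of the complement of the origin under the truncation map $\mathcal{L}\mathbb{A}^1\to\mathcal{L}_d\mathbb{A}^1=\operatorname{Spec}k[x_0,\dots,x_d]$. Consider the morphisms $$\alpha_d:\mathcal{Q}_d\times\mathcal{L}\mathbb{G}_m\to\mathcal{L}\mathbb{A}^{\le d},\quad (q,u)\mapsto qu,$$ $$\beta_d:\mathcal{Q}_d\times A_d\times\mathcal{L}\mathbb{A}^1\to\mathcal{Q}_d\times\mathcal{L}\mathbb{A}^1,\quad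 (q,v,\xi)\mapsto(q,v+q\xi).$$ For a scheme $Z$ and a point $x\in Z$, the formal completion $\hat Z_x$ is the formal spectrum of $\hat{\mathcal{O}}_{Z,x}=\varprojlim_n\mathcal{O}_{Z,x}/\mathfrak{m}_x^n$ with its projective limit topology (each quotient being discrete). A morphism of $k$-schemes $f:Z\to S$ is pro-smooth if it is a cofiltered limit of smooth morphisms $Z_i\to S$ with affine transition morphisms (otherwise arbitrary). It is Weierstrass if it is pro-smooth and, for every $k$-point $x$ of $Z$, the induced morphism $\hat f_x:\hat Z_x\to\hat S_{f(x)}$ is formally smooth: for every discrete ring $C$ and every nilpotent ideal $J\subset C$, any continuous homomorphisms $\hat{\mathcal{O}}_{S,f(x)}\to C$ and $\hat{\mathcal{O}}_{Z,x}\to C/J$ that induce the same homomorphism $\hat{\mathcal{O}}_{S,f(x)}\to C/J$ come from a continuous homomorphism $\hat{\mathcal{O}}_{Z,x}\to C$. It is strictly Weierstrass at a $k$-point $x$ of $Z$ if it is pro-smooth and $\hat f_x$ is an isomorphism. Then: 1. $\alpha_d$ is Weierstrass and surjective, and it is strictly Weierstrass at every $k$-point of the form $(t^d,u)$. 2. $\beta_d$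 is Weierstrass and surjective, and it is strictly Weierstrass at every $k$-point $(q,v,\xi)$ with $q=t^d$. -/

import Mathlib

open CategoryTheory CategoryTheory.Limits AlgebraicGeometry
open scoped TensorProduct PowerSeries Polynomial

universe u

noncomputable section

namespace ArcSpace

/-! ### Formal completions at a point -/

/-- The completed local ring `lim O_{X,x} / m_x ^ n` of a scheme at a point. -/
def CompletedStalk (X : Scheme.{u}) (x : X) : Type u :=
  AdicCompletion (IsLocalRing.maximalIdeal (X.presheaf.stalk x)) (X.presheaf.stalk x)

instance (X : Scheme.{u}) (x : X) : CommRing (CompletedStalk X x) :=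
  inferInstanceAs (CommRing
    (AdicCompletion (IsLocalRing.maximalIdeal (X.presheaf.stalk x)) (X.presheaf.stalk x)))

/-- The projection of the completed local ring to `O_{X,x} / m_x ^ n`. -/
def CompletedStalk.proj (X : Scheme.{u}) (x : X) (n : ℕ) :
    CompletedStalk X x →+*
      X.presheaf.stalk x ⧸ (IsLocalRing.maximalIdeal (X.presheaf.stalk x)) ^ n :=
  (AdicCompletion.evalₐ (IsLocalRing.maximalIdeal (X.presheaf.stalk x)) n).toRingHom

/-- The completed local ring carries the projective limit topology of the discrete rings
`O_{X,x} / m_x ^ n`. (As `m_x` need not be finitely generated, this can be coarser than the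
adic topology for the ideal generated by `m_x`.) The formal completion of `X` at `x` is the
formal spectrum of this topological ring. -/
instance (X : Scheme.{u}) (x : X) : TopologicalSpace (CompletedStalk X x) :=
  ⨅ n : ℕ, TopologicalSpace.induced (CompletedStalk.proj X x n) ⊥

theorem maximalIdeal_pow_le_comap {X Y : Scheme.{u}} (f : X ⟶ Y) (x : X) (n : ℕ) :
    (IsLocalRing.maximalIdeal (Y.presheaf.stalk (f x))) ^ n ≤
      ((IsLocalRing.maximalIdeal (X.presheaf.stalk x)) ^ n).comap (f.stalkMap x).hom := by
  refine le_trans (Ideal.pow_right_mono ?_ n) (Ideal.le_comap_pow _ n)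
  exact (IsLocalRing.maximalIdeal_comap (f.stalkMap x).hom).ge

/-- The map `O_{Y,f(x)} / m ^ n → O_{X,x} / m ^ n` induced by `f`. -/
def stalkQuotientMap {X Y : Scheme.{u}} (f : X ⟶ Y) (x : X) (n : ℕ) :
    Y.presheaf.stalk (f x) ⧸ (IsLocalRing.maximalIdeal (Y.presheaf.stalk (f x))) ^ n →+*
      X.presheaf.stalk x ⧸ (IsLocalRing.maximalIdeal (X.presheaf.stalk x)) ^ n :=
  Ideal.quotientMap _ (f.stalkMap x).hom (maximalIdeal_pow_le_comap f x n)

theorem factor_stalkQuotientMap_proj {X Y : Scheme.{u}} (f : X ⟶ Y) (x : X) {m n : ℕ}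
    (hle : m ≤ n) :
    (Ideal.Quotient.factorPow (IsLocalRing.maximalIdeal (X.presheaf.stalk x)) hle).comp
        ((stalkQuotientMap f x n).comp (CompletedStalk.proj Y (f x) n)) =
      (stalkQuotientMap f x m).comp (CompletedStalk.proj Y (f x) m) := by
  apply RingHom.ext
  intro a
  obtain ⟨b, hb⟩ := AdicCompletion.mk_surjective
    (IsLocalRing.maximalIdeal (Y.presheaf.stalk (f x))) _ a
  have h : ∀ l : ℕ, CompletedStalk.proj Y (f x) l a = Ideal.Quotient.mk _ (b.val l) := by
    intro l
    rw [← AdicCompletion.evalₐ_mk, hb]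
    rfl
  rw [RingHom.comp_apply, RingHom.comp_apply, RingHom.comp_apply, h m, h n,
    ← AdicCompletion.Ideal.mk_eq_mk _ hle b]
  rfl

/-- The map of completed local rings induced by `f` at `x`. It is the comorphism of the map
of formal completions at `x` and `f x`. -/
def completedStalkMap {X Y : Scheme.{u}} (f : X ⟶ Y) (x : X) :
    CompletedStalk Y (f x) →+* CompletedStalk X x :=
  AdicCompletion.liftRingHom (IsLocalRing.maximalIdeal (X.presheaf.stalk x))
    (fun n => (stalkQuotientMap f x n).comp (CompletedStalk.proj Y (f x) n))
    (factor_stalkQuotientMap_proj f x)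

/-- A homomorphism of topological rings `φ : A → B` is formally smooth when every lifting
problem given by a discrete ring `C`, a nilpotent ideal `J`, and continuous homomorphisms
`A → C` and `B → C / J` that agree on `A` has a continuous solution `B → C`. -/
def IsTopFormallySmooth {A B : Type u} [CommRing A] [TopologicalSpace A] [CommRing B]
    [TopologicalSpace B] (φ : A →+* B) : Prop :=
  ∀ (C : Type u) [CommRing C] [TopologicalSpace C] [DiscreteTopology C] (J : Ideal C)
    [TopologicalSpace (C ⧸ J)] [DiscreteTopology (C ⧸ J)],
    IsNilpotent J → ∀ (a : A →+* C) (b : B →+* C ⧸ J), Continuous a → Continuous b →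
      (Ideal.Quotient.mk J).comp a = b.comp φ →
      ∃ c : B →+* C, Continuous c ∧ c.comp φ = a ∧ (Ideal.Quotient.mk J).comp c = b

/-! ### Pro-smooth and Weierstrass morphisms -/

/-- `f` is pro-smooth: it is a cofiltered limit of smooth morphisms with affine transition
morphisms. -/
def IsProSmooth {Z S : Scheme.{u}} (f : Z ⟶ S) : Prop :=
  ∃ (I : Type u) (_ : SmallCategory I) (_ : IsCofiltered I) (D : I ⥤ Over S)
    (π : (Functor.const I).obj (Over.mk f) ⟶ D),
    (∀ i, Smooth (D.obj i).hom) ∧ (∀ (i j : I) (φ : i ⟶ j), IsAffineHom (D.map φ).left) ∧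
      Nonempty (IsLimit (Cone.mk (Over.mk f) π))

variable {k : Type u} [Field k]

/-- The `k`-points of a `k`-scheme. -/
abbrev KPoint (Z : Over (Spec (CommRingCat.of k))) : Type u :=
  Over.mk (𝟙 (Spec (CommRingCat.of k))) ⟶ Z

/-- The underlying point of a `k`-point. -/
def KPoint.pt {Z : Over (Spec (CommRingCat.of k))} (x : KPoint Z) : Z.left :=
  x.left (IsLocalRing.closedPoint k)

/-- `f` is Weierstrass: it is pro-smooth and the map of formal completions at every `k`-point
is formally smooth. -/
def IsWeierstrass {Z S : Over (Spec (CommRingCat.of k))} (f : Z ⟶ S) : Prop :=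
  IsProSmooth f.left ∧ ∀ x : KPoint Z, IsTopFormallySmooth (completedStalkMap f.left x.pt)

/-- `f` is strictly Weierstrass at the `k`-point `x`: it is pro-smooth and the map of formal
completions at `x` is an isomorphism (of topological rings). -/
def IsStrictlyWeierstrassAt {Z S : Over (Spec (CommRingCat.of k))} (f : Z ⟶ S)
    (x : KPoint Z) : Prop :=
  IsProSmooth f.left ∧ IsHomeomorph (completedStalkMap f.left x.pt)

/-! ### The spaces of polynomials and of arcs -/

variable (k)

/-- The affine `k`-scheme of a `k`-algebra. -/
def affine (A : Type u) [CommRing A] [Algebra k A] : Over (Spec (CommRingCat.of k)) :=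
  Over.mk (Spec.map (CommRingCat.ofHom (algebraMap k A)))

/-- The morphism of affine `k`-schemes given by a homomorphism of `k`-algebras. -/
def affineMap {A B : Type u} [CommRing A] [Algebra k A] [CommRing B] [Algebra k B]
    (φ : A →ₐ[k] B) : affine k B ⟶ affine k A :=
  Over.homMk (Spec.map (CommRingCat.ofHom φ.toRingHom)) (by
    change Spec.map _ ≫ Spec.map _ = Spec.map _
    rw [← Spec.map_comp, ← CommRingCat.ofHom_comp]
    congr 2
    exact φ.comp_algebraMap)

/-- The value at a `k`-point of the functions on an affine `k`-scheme. -/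
def evalAt {A : Type u} [CommRing A] [Algebra k A] (x : KPoint (affine k A)) : A →+* k :=
  (Spec.preimage (show Spec (CommRingCat.of k) ⟶ Spec (CommRingCat.of A) from x.left)).hom

/-- The coordinate ring `k[a_0, …, a_{d-1}]` of the scheme `Q_d` of monic polynomials of
degree `d`. -/
abbrev QRing (d : ℕ) : Type u := MvPolynomial (Fin d) k

/-- The universal monic polynomial `t^d + a_{d-1} t^{d-1} + ⋯ + a_0`. -/
def univMonic (d : ℕ) : (QRing k d)[X] :=
  Polynomial.X ^ d + ∑ i : Fin d, Polynomial.C (MvPolynomial.X i) * Polynomial.X ^ (i : ℕ)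

/-- The coordinate ring `k[v_0, …, v_{d-1}]` of the scheme `A_d` of polynomials of degree at
most `d - 1`. -/
abbrev ARing (d : ℕ) : Type u := MvPolynomial (Fin d) k

/-- The universal polynomial `v_{d-1} t^{d-1} + ⋯ + v_0` of degree at most `d - 1`. -/
def univPoly (d : ℕ) : (ARing k d)[X] :=
  ∑ i : Fin d, Polynomial.C (MvPolynomial.X i) * Polynomial.X ^ (i : ℕ)

/-- The coordinate ring `k[x_0, x_1, …]` of the arc space of the affine line. -/
abbrev LA1Ring : Type u := MvPolynomial ℕ k

/-- The universal arc `x_0 + x_1 t + ⋯` of the affine line. -/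
def univArc : (LA1Ring k)⟦X⟧ := PowerSeries.mk fun n => MvPolynomial.X n

/-- The coordinate ring `k[x_0, x_0⁻¹, x_1, …]` of the arc space of the multiplicative
group. -/
abbrev LGmRing : Type u := Localization.Away (MvPolynomial.X 0 : MvPolynomial ℕ k)

/-- The universal arc of the multiplicative group, an invertible power series. -/
def univUnit : (LGmRing k)⟦X⟧ :=
  PowerSeries.map (algebraMap (MvPolynomial ℕ k) (LGmRing k)) (univArc k)

variable {k} in
/-- The homomorphism `k[x_0, x_1, …] → R` classifying a power series over `R`: it sends `x_n`
to the coefficient of `t^n`. -/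
def classify {R : Type u} [CommRing R] [Algebra k R] (f : R⟦X⟧) : LA1Ring k →ₐ[k] R :=
  MvPolynomial.aeval fun n => PowerSeries.coeff n f

theorem isUnit_univUnit : IsUnit (univUnit k) := by
  rw [PowerSeries.isUnit_iff_constantCoeff, ← PowerSeries.coeff_zero_eq_constantCoeff_apply,
    univUnit, PowerSeries.coeff_map, univArc, PowerSeries.coeff_mk]
  exact IsLocalization.Away.algebraMap_isUnit _

/-- The arc space of the multiplicative group represents `R ↦ R⟦t⟧ˣ`. -/
theorem existsUnique_classify_unit {R : Type u} [CommRing R] [Algebra k R] (f : R⟦X⟧)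
    (hf : IsUnit f) :
    ∃! φ : LGmRing k →ₐ[k] R, PowerSeries.map φ.toRingHom (univUnit k) = f := by
  have h0 : IsUnit (classify (k := k) f (MvPolynomial.X 0)) := by
    simpa [classify] using PowerSeries.isUnit_iff_constantCoeff.mp hf
  have hx : ∀ y : Submonoid.powers (MvPolynomial.X 0 : MvPolynomial ℕ k),
      IsUnit (classify (k := k) f y) := by
    rintro ⟨_, n, rfl⟩
    simpa using h0.pow n
  have key : ∀ ψ : LGmRing k →ₐ[k] R, PowerSeries.map ψ.toRingHom (univUnit k) = f → ∀ n,
      ψ (algebraMap (MvPolynomial ℕ k) (LGmRing k) (MvPolynomial.X n)) =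
        PowerSeries.coeff n f := by
    intro ψ hψ n
    simpa [univUnit, univArc] using congrArg (PowerSeries.coeff n) hψ
  refine existsUnique_of_exists_of_unique
    ⟨IsLocalization.liftAlgHom (M := Submonoid.powers (MvPolynomial.X 0)) hx, ?_⟩ ?_
  · ext n
    simp [univUnit, univArc, classify]
  · intro ψ₁ ψ₂ h₁ h₂
    apply IsLocalization.algHom_ext (Submonoid.powers (MvPolynomial.X 0 : MvPolynomial ℕ k))
    apply MvPolynomial.algHom_ext
    intro n
    exact (key ψ₁ h₁ n).trans (key ψ₂ h₂ n).symm

/-- The scheme `L_d A^1 = Spec k[x_0, …, x_d]` of truncated arcs `Spec R[t]/(t^{d+1}) → A^1`. -/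
def jetA1 (d : ℕ) : Over (Spec (CommRingCat.of k)) := affine k (MvPolynomial (Fin (d + 1)) k)

/-- The truncation map from the arc space of the affine line to `L_d A^1`. -/
def ev (d : ℕ) : affine k (LA1Ring k) ⟶ jetA1 k d :=
  affineMap k (MvPolynomial.rename fun i : Fin (d + 1) => (i : ℕ))

/-- The complement of the origin in `L_d A^1`. -/
def jetMinusZero (d : ℕ) : (jetA1 k d).left.Opens :=
  ⟨(PrimeSpectrum.zeroLocus
      (Set.range (MvPolynomial.X : Fin (d + 1) → MvPolynomial (Fin (d + 1)) k)))ᶜ,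
    (PrimeSpectrum.isClosed_zeroLocus _).isOpen_compl⟩

/-- The open subscheme of arcs of valuation at most `d`, the inverse image under `ev` of the
complement of the origin. -/
def arcsLEOpen (d : ℕ) : (affine k (LA1Ring k)).left.Opens :=
  (ev k d).left ⁻¹ᵁ jetMinusZero k d

/-- The `k`-scheme of arcs of the affine line of valuation at most `d`. -/
def arcsLE (d : ℕ) : Over (Spec (CommRingCat.of k)) :=
  Over.mk ((arcsLEOpen k d).ι ≫ (affine k (LA1Ring k)).hom)

/-! ### The morphism `α_d : Q_d × L G_m → L A^{≤ d}`, `(q, u) ↦ q u` -/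

/-- The coordinate ring of `Q_d × L G_m`. -/
abbrev AlphaRing (d : ℕ) : Type u := QRing k d ⊗[k] LGmRing k

/-- The first component `q` of the universal pair `(q, u)`. -/
def alphaPoly (d : ℕ) : (AlphaRing k d)[X] :=
  (univMonic k d).map
    (Algebra.TensorProduct.includeLeft : QRing k d →ₐ[k] AlphaRing k d).toRingHom

/-- The second component `u` of the universal pair `(q, u)`. -/
def alphaUnit (d : ℕ) : (AlphaRing k d)⟦X⟧ :=
  PowerSeries.map
    (Algebra.TensorProduct.includeRight : LGmRing k →ₐ[k] AlphaRing k d).toRingHom (univUnit k)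

/-- The morphism `(q, u) ↦ q u` from `Q_d × L G_m` to the arc space of the affine line. -/
def alphaToArcs (d : ℕ) : affine k (AlphaRing k d) ⟶ affine k (LA1Ring k) :=
  affineMap k (classify ((alphaPoly k d : (AlphaRing k d)⟦X⟧) * alphaUnit k d))

theorem range_alphaToArcs (d : ℕ) :
    Set.range (alphaToArcs k d).left ⊆ Set.range (arcsLEOpen k d).ι := by
  rw [Scheme.Opens.range_ι]
  rintro _ ⟨p, rfl⟩
  change PrimeSpectrum (AlphaRing k d) at p
  set q : (AlphaRing k d)⟦X⟧ := (alphaPoly k d : (AlphaRing k d)⟦X⟧) with hq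
  set φ := classify (k := k) (q * alphaUnit k d) with hφ
  intro hmem
  have hp : ∀ i : Fin (d + 1), φ (MvPolynomial.rename (fun i : Fin (d + 1) => (i : ℕ))
      (MvPolynomial.X i)) ∈ p.asIdeal := fun i => hmem ⟨i, rfl⟩
  have hp' : ∀ i, i ≤ d → PowerSeries.coeff i (q * alphaUnit k d) ∈ p.asIdeal := by
    intro i hi
    have := hp ⟨i, Nat.lt_succ_of_le hi⟩
    rw [MvPolynomial.rename_X] at this
    simpa [hφ, classify] using this
  have hu : IsUnit (alphaUnit k d) := (isUnit_univUnit k).map _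
  obtain ⟨w, hw⟩ := hu.exists_right_inv
  have h1 : q = q * alphaUnit k d * w := by rw [mul_assoc, hw, mul_one]
  have hc : PowerSeries.coeff d q = 1 := by
    rw [hq, Polynomial.coeff_coe, alphaPoly, Polynomial.coeff_map]
    have : (univMonic k d).coeff d = 1 := by
      have h0 : ∀ i : Fin d, d ≠ (i : ℕ) := fun i => i.2.ne'
      simp [univMonic, Polynomial.coeff_X_pow, h0]
    rw [this, map_one]
  apply p.2.ne_top
  rw [Ideal.eq_top_iff_one, ← hc, h1, PowerSeries.coeff_mul]
  refine Ideal.sum_mem _ fun ij hij => Ideal.mul_mem_right _ _ (hp' _ ?_)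
  have := Finset.HasAntidiagonal.mem_antidiagonal.mp hij
  omega

/-- The morphism `α_d` as a morphism of schemes: the factorization of `(q, u) ↦ q u` through
the open subscheme of arcs of valuation at most `d`. -/
def alphaScheme (d : ℕ) : (affine k (AlphaRing k d)).left ⟶ (arcsLEOpen k d).toScheme :=
  IsOpenImmersion.lift (arcsLEOpen k d).ι (alphaToArcs k d).left (range_alphaToArcs k d)

theorem alphaScheme_comp (d : ℕ) :
    alphaScheme k d ≫ (arcsLEOpen k d).ι = (alphaToArcs k d).left :=
  IsOpenImmersion.lift_fac _ _ _

/-- The morphism `α_d : Q_d × L G_m → L A^{≤ d}`, `(q, u) ↦ q u`, over `k`. -/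
def alpha (d : ℕ) : affine k (AlphaRing k d) ⟶ arcsLE k d :=
  Over.homMk (alphaScheme k d) (by
    change alphaScheme k d ≫ (arcsLEOpen k d).ι ≫ (affine k (LA1Ring k)).hom = _
    rw [← Category.assoc, alphaScheme_comp]
    exact Over.w (alphaToArcs k d))

/-! ### The morphism `β_d : Q_d × A_d × L A^1 → Q_d × L A^1`, `(q, v, ξ) ↦ (q, v + q ξ)` -/

/-- The coordinate ring of `Q_d × A_d × L A^1`. -/
abbrev BetaRing (d : ℕ) : Type u := QRing k d ⊗[k] (ARing k d ⊗[k] LA1Ring k)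

/-- The component `q` of the universal triple `(q, v, ξ)`. -/
def betaPoly (d : ℕ) : (BetaRing k d)[X] :=
  (univMonic k d).map
    (Algebra.TensorProduct.includeLeft : QRing k d →ₐ[k] BetaRing k d).toRingHom

/-- The component `v` of the universal triple `(q, v, ξ)`. -/
def betaRem (d : ℕ) : (BetaRing k d)[X] :=
  (univPoly k d).map
    ((Algebra.TensorProduct.includeRight : ARing k d ⊗[k] LA1Ring k →ₐ[k] BetaRing k d).comp
      (Algebra.TensorProduct.includeLeft : ARing k d →ₐ[k] ARing k d ⊗[k] LA1Ring k)).toRingHom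

/-- The component `ξ` of the universal triple `(q, v, ξ)`. -/
def betaArc (d : ℕ) : (BetaRing k d)⟦X⟧ :=
  PowerSeries.map
    ((Algebra.TensorProduct.includeRight : ARing k d ⊗[k] LA1Ring k →ₐ[k] BetaRing k d).comp
      (Algebra.TensorProduct.includeRight : LA1Ring k →ₐ[k] ARing k d ⊗[k] LA1Ring k)).toRingHom
    (univArc k)

/-- The morphism `β_d : Q_d × A_d × L A^1 → Q_d × L A^1`, `(q, v, ξ) ↦ (q, v + q ξ)`. -/
def beta (d : ℕ) : affine k (BetaRing k d) ⟶ affine k (QRing k d ⊗[k] LA1Ring k) :=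
  affineMap k (Algebra.TensorProduct.productMap
    (Algebra.TensorProduct.includeLeft : QRing k d →ₐ[k] BetaRing k d)
    (classify ((betaRem k d : (BetaRing k d)⟦X⟧) + (betaPoly k d : (BetaRing k d)⟦X⟧) * betaArc k d)))

end ArcSpace

end

noncomputable section

namespace ArcSpace

/-! ### Continuous homomorphisms on completed local rings -/

/-! Both morphisms are division problems. For `β_d` one solves `v + q ξ = f` with `q` given. For
`α_d` the equation `q u = f` linearizes to `q μ + v u = r`, and `μ = u ξ` turns this into `v + q ξ =
u⁻¹ r`. Everything rests on dividing by the monic `q`, in two different settings.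

Formal neighbourhoods: at a `k`-point, `q = t^e w` with `w` a unit of `k⟦t⟧` and `e ≤ d`, because
the coefficient of `t^d` is 1. On a discrete test ring the functions vanishing at the point become
nilpotent, so `q` is `t^e w` modulo a nilpotent ideal. Division with remainder of degree less than
`e ≤ d` then succeeds after finitely many corrections (`exists_division`). It solves the lifting
problem for `β_d` directly, and the one for `α_d` through Newton iteration (`exists_factorization`).
Since localizing at a maximal ideal does not change the quotients by its powers, these lifting
problems can be posed on coordinate rings (`LiftsNilpotentAt`,
`isTopFormallySmooth_completedStalkMap`).

Strictness: if `q = t^d` at the point, the division is unique, so the scheme-theoretic fibre through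
the point is a reduced point and the maximal ideal is generated by functions from the target. This
makes the maps `O / m ^ n → O / m ^ n` surjective. They are injective because the lifting property
provides a retraction (`LiftsNilpotentAt.mem_pow_of_map_mem_pow`).

Pro-smoothness: modulo `t^N` there are finitely many unknowns and equations, and `f` may be replaced
by a polynomial. Euclidean division by a monic polynomial works over every ring
(`exists_division_of_monic`), so the truncated equations satisfy the infinitesimal lifting
criterion, and the morphism is the limit over `N` (`isProSmooth_of_presentation`). For `α_d` one
takes `N > d`, so that each truncated problem already lives over the arcs of valuation at most `d`.

Surjectivity: over a field an arc of valuation `e ≤ d` is `t^e` times a unit. For `α_d` one may take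
`q = t^d + t^e` if `e < d` and `q = t^d` if `e = d`. For `β_d` one divides by the given `q`, itself
a power of `t` times a unit. -/

theorem CompletedStalk.proj_surjective (X : Scheme.{u}) (x : X) (n : ℕ) :
    Function.Surjective (CompletedStalk.proj X x n) :=
  AdicCompletion.surjective_evalₐ _ n

theorem CompletedStalk.ext_proj {X : Scheme.{u}} {x : X} {a b : CompletedStalk X x}
    (h : ∀ n, CompletedStalk.proj X x n a = CompletedStalk.proj X x n b) : a = b :=
  AdicCompletion.ext_evalₐ (I := IsLocalRing.maximalIdeal (X.presheaf.stalk x)) h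

theorem proj_completedStalkMap {X Y : Scheme.{u}} (f : X ⟶ Y) (x : X) (n : ℕ)
    (a : CompletedStalk Y (f x)) :
    CompletedStalk.proj X x n (completedStalkMap f x a) =
      stalkQuotientMap f x n (CompletedStalk.proj Y (f x) n a) :=
  AdicCompletion.evalₐ_liftRingHom _ _ _ n a

theorem CompletedStalk.factorPow_proj {X : Scheme.{u}} {x : X} {m n : ℕ} (h : m ≤ n)
    (a : CompletedStalk X x) :
    Ideal.Quotient.factorPow (IsLocalRing.maximalIdeal (X.presheaf.stalk x)) h
      (CompletedStalk.proj X x n a) = CompletedStalk.proj X x m a := by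
  obtain ⟨b, rfl⟩ := AdicCompletion.mk_surjective
    (IsLocalRing.maximalIdeal (X.presheaf.stalk x)) _ a
  have hb : ∀ l : ℕ, CompletedStalk.proj X x l (AdicCompletion.mk _ _ b) =
      Ideal.Quotient.mk _ (b.val l) := fun l => AdicCompletion.evalₐ_mk _ l b
  rw [hb, hb, ← AdicCompletion.Ideal.mk_eq_mk _ h b]
  rfl

theorem CompletedStalk.isOpen_preimage_proj (X : Scheme.{u}) (x : X) (n : ℕ)
    (s : Set (X.presheaf.stalk x ⧸ (IsLocalRing.maximalIdeal (X.presheaf.stalk x)) ^ n)) :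
    IsOpen (CompletedStalk.proj X x n ⁻¹' s) := by
  refine (iInf_le (fun n => TopologicalSpace.induced (CompletedStalk.proj X x n) ⊥) n) _ ?_
  exact ⟨s, trivial, rfl⟩

theorem CompletedStalk.continuous_of_proj {X : Scheme.{u}} {x : X} {C : Type*} [CommRing C]
    [TopologicalSpace C] (c : CompletedStalk X x →+* C) (n : ℕ)
    (h : ∀ a, CompletedStalk.proj X x n a = 0 → c a = 0) : Continuous c := by
  refine ⟨fun s _ => ?_⟩
  convert CompletedStalk.isOpen_preimage_proj X x n (CompletedStalk.proj X x n '' (c ⁻¹' s))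
  refine (Set.subset_preimage_image _ _).antisymm ?_
  rintro a ⟨b, hb, hab⟩
  have : c a = c b := by
    rw [← sub_eq_zero, ← map_sub]
    exact h _ (by rw [map_sub, hab, sub_self])
  simpa [this] using hb

/-- The kernel is an open neighbourhood of 0. The kernels of the projections decrease with `n`, so
the infimum of topologies is directed at 0 and a single level `n` already suffices. -/
theorem CompletedStalk.exists_proj_of_continuous {X : Scheme.{u}} {x : X} {C : Type*} [CommRing C]
    [TopologicalSpace C] [DiscreteTopology C] (c : CompletedStalk X x →+* C) (hc : Continuous c) :
    ∃ n, ∀ a, CompletedStalk.proj X x n a = 0 → c a = 0 := by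
  have h0 : c ⁻¹' {0} ∈ nhds (0 : CompletedStalk X x) :=
    (hc.isOpen_preimage _ (isOpen_discrete _)).mem_nhds (map_zero c)
  rw [nhds_iInf, Filter.mem_iInf_of_directed] at h0
  · obtain ⟨n, hn⟩ := h0
    refine ⟨n, fun a ha => ?_⟩
    let : TopologicalSpace (X.presheaf.stalk x ⧸
      (IsLocalRing.maximalIdeal (X.presheaf.stalk x)) ^ n) := ⊥
    rw [nhds_induced] at hn
    obtain ⟨t, ht, hts⟩ := hn
    exact hts (show CompletedStalk.proj X x n a ∈ t by
      rw [ha, ← map_zero (CompletedStalk.proj X x n)]; exact mem_of_mem_nhds ht)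
  · have key : Antitone fun n : ℕ => @nhds _
        (TopologicalSpace.induced (CompletedStalk.proj X x n) ⊥) (0 : CompletedStalk X x) := by
      intro m n hmn
      let (l : ℕ) : TopologicalSpace (X.presheaf.stalk x ⧸
        (IsLocalRing.maximalIdeal (X.presheaf.stalk x)) ^ l) := ⊥
      have (l : ℕ) : DiscreteTopology (X.presheaf.stalk x ⧸
        (IsLocalRing.maximalIdeal (X.presheaf.stalk x)) ^ l) := ⟨rfl⟩
      simp only [nhds_induced]
      rw [map_zero, map_zero, nhds_discrete, nhds_discrete]
      simp only [Filter.comap_pure, Filter.le_principal_iff, Filter.mem_principal]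
      intro a ha
      change CompletedStalk.proj X x m a = 0
      rw [← CompletedStalk.factorPow_proj hmn, show CompletedStalk.proj X x n a = 0 from ha, map_zero]
    exact key.directed_ge

/-- Both sides are limits of the discrete quotients, in rings and in topology, so a levelwise
bijection gives an isomorphism. Working level by level avoids any finiteness of the maximal ideals.
-/
theorem isHomeomorph_completedStalkMap {X Y : Scheme.{u}} (f : X ⟶ Y) (x : X)
    (h : ∀ n, Function.Bijective (stalkQuotientMap f x n)) :
    IsHomeomorph (completedStalkMap f x) := by
  rw [isHomeomorph_iff_isEmbedding_surjective]
  have inj : Function.Injective (completedStalkMap f x) := fun a b hab =>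
    CompletedStalk.ext_proj fun n => (h n).1 <| by
      rw [← proj_completedStalkMap, ← proj_completedStalkMap, hab]
  refine ⟨⟨⟨?_⟩, inj⟩, ?_⟩
  · change iInf _ = TopologicalSpace.induced _ (iInf _)
    rw [induced_iInf]
    congr 1
    ext1 n
    rw [induced_compose]
    have : CompletedStalk.proj X x n ∘ completedStalkMap f x =
        stalkQuotientMap f x n ∘ CompletedStalk.proj Y (f x) n :=
      funext fun a => proj_completedStalkMap f x n a
    rw [this, ← induced_compose]
    congr 1
    symm
    let : TopologicalSpace (X.presheaf.stalk x ⧸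
        (IsLocalRing.maximalIdeal (X.presheaf.stalk x)) ^ n) := ⊥
    refine eq_bot_of_singletons_open fun a => ⟨{stalkQuotientMap f x n a}, trivial, ?_⟩
    ext b
    simp [(h n).1.eq_iff]
  · intro b
    -- The levelwise inverses form a compatible family, which assembles to a preimage of `b`.
    let e (n : ℕ) := RingEquiv.ofBijective (stalkQuotientMap f x n) (h n)
    let g (n : ℕ) := (e n).symm.toRingHom.comp (CompletedStalk.proj X x n)
    have hg : ∀ n a, stalkQuotientMap f x n (g n a) = CompletedStalk.proj X x n a :=
      fun n a => (e n).apply_symm_apply _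
    have hcompat : ∀ {m n : ℕ} (hle : m ≤ n),
        (Ideal.Quotient.factorPow (IsLocalRing.maximalIdeal (Y.presheaf.stalk (f x))) hle).comp
          (g n) = g m := by
      intro m n hle
      ext a
      apply (h m).1
      obtain ⟨z, hz⟩ := CompletedStalk.proj_surjective Y (f x) n (g n a)
      have h1 := RingHom.congr_fun (factor_stalkQuotientMap_proj f x hle) z
      simp only [RingHom.comp_apply] at h1 ⊢
      rw [← hz, CompletedStalk.factorPow_proj, ← h1, hz, hg, hg, CompletedStalk.factorPow_proj]
    refine ⟨AdicCompletion.liftRingHom _ g hcompat b, CompletedStalk.ext_proj fun n => ?_⟩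
    refine (proj_completedStalkMap f x n _).trans
      ((congrArg _ (AdicCompletion.evalₐ_liftRingHom _ _ _ n b)).trans (hg n b))

/-! ### Local rings of open subschemes of affine schemes -/

/-- The homomorphism from the coordinate ring of `Spec R` to the local ring of `X` at `x` induced
by a morphism `X ⟶ Spec R`. -/
def chartStalk {X : Scheme.{u}} {R : CommRingCat.{u}} (g : X ⟶ Spec R) (x : X) :
    R →+* X.presheaf.stalk x :=
  ((Scheme.ΓSpecIso R).inv ≫ g.appTop ≫ X.presheaf.germ ⊤ x trivial).hom

theorem chartStalk_eq {X : Scheme.{u}} {R : CommRingCat.{u}} (g : X ⟶ Spec R) (x : X) :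
    chartStalk g x = (g.stalkMap x).hom.comp (StructureSheaf.toStalk R (g x)).hom := by
  refine (congrArg CommRingCat.Hom.hom (congrArg ((Scheme.ΓSpecIso R).inv ≫ ·)
    (Scheme.Hom.germ_stalkMap g ⊤ x trivial).symm)).trans ?_
  refine (congrArg (fun r => (g.stalkMap x).hom.comp (CommRingCat.Hom.hom r))
    (StructureSheaf.algebraMap_germ (R := R) ⊤ (g x) trivial))

theorem stalkMap_comp_chartStalk {X Y : Scheme.{u}} {R S : CommRingCat.{u}} (f : X ⟶ Y)
    (g : Y ⟶ Spec R) (h : X ⟶ Spec S) (φ : R ⟶ S) (w : f ≫ g = h ≫ Spec.map φ) (x : X) :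
    (f.stalkMap x).hom.comp (chartStalk g (f x)) = (chartStalk h x).comp φ.hom := by
  have h1 : Y.presheaf.germ ⊤ (f x) trivial ≫ f.stalkMap x =
    f.appTop ≫ X.presheaf.germ ⊤ x trivial := Scheme.Hom.germ_stalkMap f ⊤ x trivial
  have h2 : (Spec.map φ).appTop = (Scheme.ΓSpecIso R).hom ≫ φ ≫ (Scheme.ΓSpecIso S).inv := by
    rw [← Scheme.ΓSpecIso_naturality_assoc, Iso.hom_inv_id, Category.comp_id]
  rw [chartStalk, chartStalk, ← CommRingCat.hom_comp, ← CommRingCat.hom_comp]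
  congr 1
  rw [Category.assoc, Category.assoc, h1, ← Scheme.Hom.comp_appTop_assoc, w,
    Scheme.Hom.comp_appTop_assoc, h2]
  simp

theorem isLocalization_chartStalk {X : Scheme.{u}} {R : CommRingCat.{u}} (g : X ⟶ Spec R)
    [IsOpenImmersion g] (x : X) (p : PrimeSpectrum R) (hp : g x = p) :
    @IsLocalization.AtPrime R _ (X.presheaf.stalk x) _ (chartStalk g x).toAlgebra
      p.asIdeal _ := by
  subst hp
  let e : (Spec R).presheaf.stalk (g x) ≃+* X.presheaf.stalk x :=
    (asIso (g.stalkMap x)).commRingCatIsoToRingEquiv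
  let : Algebra R ((Spec R).presheaf.stalk (g x)) := StructureSheaf.stalkAlgebra (R := R) (g x)
  have := (PrimeSpectrum.isPrime (R := R) (g x))
  have h := (IsLocalization.isLocalization_iff_of_ringEquiv
    (PrimeSpectrum.asIdeal (R := R) (g x)).primeCompl e).mp
    (StructureSheaf.IsLocalization.to_stalk (R := R) (g x))
  rw [chartStalk_eq]
  exact h

/-- Elements outside a maximal ideal are already units modulo its powers, so localization leaves `R
/ p ^ n` unchanged. -/
theorem exists_sub_chartStalk_mem {X : Scheme.{u}} {R : CommRingCat.{u}} (g : X ⟶ Spec R)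
    [IsOpenImmersion g] (x : X) (p : PrimeSpectrum R) (hp : g x = p) [p.asIdeal.IsMaximal] (n : ℕ)
    (a : X.presheaf.stalk x) :
    ∃ r : R, a - chartStalk g x r ∈ IsLocalRing.maximalIdeal (X.presheaf.stalk x) ^ n := by
  let := (chartStalk g x).toAlgebra
  have := isLocalization_chartStalk g x p hp
  obtain ⟨q, hq⟩ := (IsLocalization.AtPrime.equivQuotMaximalIdealPow p.asIdeal
    (X.presheaf.stalk x) n).surjective (Ideal.Quotient.mk _ a)
  obtain ⟨r, rfl⟩ := Ideal.Quotient.mk_surjective q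
  exact ⟨r, Ideal.Quotient.eq.mp hq.symm⟩

theorem chartStalk_mem_maximalIdeal_pow {X : Scheme.{u}} {R : CommRingCat.{u}} (g : X ⟶ Spec R)
    [IsOpenImmersion g] (x : X) (p : PrimeSpectrum R) (hp : g x = p) [p.asIdeal.IsMaximal] (n : ℕ)
    (r : R) :
    chartStalk g x r ∈ IsLocalRing.maximalIdeal (X.presheaf.stalk x) ^ n ↔ r ∈ p.asIdeal ^ n := by
  let := (chartStalk g x).toAlgebra
  have := isLocalization_chartStalk g x p hp
  have h := (IsLocalization.AtPrime.equivQuotMaximalIdealPow p.asIdeal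
    (X.presheaf.stalk x) n).toRingEquiv.map_eq_zero_iff (x := Ideal.Quotient.mk _ r)
  rw [← Ideal.Quotient.eq_zero_iff_mem, ← Ideal.Quotient.eq_zero_iff_mem (I := p.asIdeal ^ n)]
  exact h

/-- The homomorphism from the completed local ring induced by a homomorphism that kills a power of
the maximal ideal. -/
theorem exists_completedStalk_lift {X : Scheme.{u}} {R : CommRingCat.{u}} (g : X ⟶ Spec R)
    [IsOpenImmersion g] (x : X) (p : PrimeSpectrum R) (hp : g x = p) [p.asIdeal.IsMaximal] (n : ℕ)
    {C : Type u} [CommRing C] (c : R →+* C) (hc : ∀ r ∈ p.asIdeal ^ n, c r = 0) :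
    ∃ c' : CompletedStalk X x →+* C,
      (∀ a, CompletedStalk.proj X x n a = 0 → c' a = 0) ∧
      ∀ a r, CompletedStalk.proj X x n a = Ideal.Quotient.mk _ (chartStalk g x r) → c' a = c r := by
  let := (chartStalk g x).toAlgebra
  have := isLocalization_chartStalk g x p hp
  let e := IsLocalization.AtPrime.equivQuotMaximalIdealPow p.asIdeal (X.presheaf.stalk x) n
  let c₁ : R ⧸ p.asIdeal ^ n →+* C := Ideal.Quotient.lift _ c hc
  refine ⟨(c₁.comp e.symm.toRingEquiv.toRingHom).comp (CompletedStalk.proj X x n),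
    fun a ha => ?_, fun a r har => ?_⟩
  · rw [RingHom.comp_apply, ha, map_zero]
  · have h1 : e.symm (CompletedStalk.proj X x n a) = Ideal.Quotient.mk _ r := by
      rw [har, AlgEquiv.symm_apply_eq]
      exact (IsLocalization.AtPrime.equivQuotMaximalIdealPow_apply_mk _ _ n r).symm
    exact (congrArg c₁ h1).trans (Ideal.Quotient.lift_mk _ _ _)

theorem exists_proj_eq_chartStalk {X : Scheme.{u}} {R : CommRingCat.{u}} (g : X ⟶ Spec R)
    [IsOpenImmersion g] (x : X) (p : PrimeSpectrum R) (hp : g x = p) [p.asIdeal.IsMaximal] (n : ℕ)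
    (a : CompletedStalk X x) :
    ∃ r : R, CompletedStalk.proj X x n a = Ideal.Quotient.mk _ (chartStalk g x r) := by
  obtain ⟨b, hb⟩ := Ideal.Quotient.mk_surjective (CompletedStalk.proj X x n a)
  obtain ⟨r, hr⟩ := exists_sub_chartStalk_mem g x p hp n b
  exact ⟨r, hb.symm.trans (Ideal.Quotient.eq.mpr hr)⟩

/-- The homomorphism from the coordinate ring to the completed local ring. -/
def chartCompletedStalk {X : Scheme.{u}} {R : CommRingCat.{u}} (g : X ⟶ Spec R) (x : X) :
    R →+* CompletedStalk X x :=
  (algebraMap (X.presheaf.stalk x)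
    (AdicCompletion (IsLocalRing.maximalIdeal (X.presheaf.stalk x)) (X.presheaf.stalk x))).comp
    (chartStalk g x)

theorem proj_chartCompletedStalk {X : Scheme.{u}} {R : CommRingCat.{u}} (g : X ⟶ Spec R) (x : X)
    (n : ℕ) (r : R) :
    CompletedStalk.proj X x n (chartCompletedStalk g x r) =
      Ideal.Quotient.mk _ (chartStalk g x r) :=
  (AdicCompletion.evalₐ (IsLocalRing.maximalIdeal (X.presheaf.stalk x)) n).commutes _

theorem completedStalkMap_chartCompletedStalk {X Y : Scheme.{u}} {R S : CommRingCat.{u}} (f : X ⟶ Y)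
    (g : Y ⟶ Spec R) (h : X ⟶ Spec S) (φ : R ⟶ S) (w : f ≫ g = h ≫ Spec.map φ) (x : X) (r : R) :
    completedStalkMap f x (chartCompletedStalk g (f x) r) = chartCompletedStalk h x (φ.hom r) := by
  refine CompletedStalk.ext_proj fun n => ?_
  rw [proj_completedStalkMap, proj_chartCompletedStalk, proj_chartCompletedStalk]
  exact congrArg (Ideal.Quotient.mk _) (RingHom.congr_fun (stalkMap_comp_chartStalk f g h φ w x) r)

/-- Both maps factor through a common level `O / m ^ n`, onto which the coordinate ring surjects. -/
theorem CompletedStalk.ringHom_ext {X : Scheme.{u}} {R : CommRingCat.{u}} (g : X ⟶ Spec R)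
    [IsOpenImmersion g] (x : X) (p : PrimeSpectrum R) (hp : g x = p) [p.asIdeal.IsMaximal]
    {C : Type u} [CommRing C] [TopologicalSpace C] [DiscreteTopology C]
    {c c' : CompletedStalk X x →+* C} (hc : Continuous c) (hc' : Continuous c')
    (h : c.comp (chartCompletedStalk g x) = c'.comp (chartCompletedStalk g x)) : c = c' := by
  obtain ⟨n, hn⟩ := CompletedStalk.exists_proj_of_continuous c hc
  obtain ⟨n', hn'⟩ := CompletedStalk.exists_proj_of_continuous c' hc'
  ext a
  obtain ⟨r, hr⟩ := exists_proj_eq_chartStalk g x p hp (max n n') a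
  rw [← proj_chartCompletedStalk, ← sub_eq_zero, ← map_sub] at hr
  have h1 := hn _ ((CompletedStalk.factorPow_proj (le_max_left n n') _).symm.trans
    (by rw [hr, map_zero]))
  have h2 := hn' _ ((CompletedStalk.factorPow_proj (le_max_right n n') _).symm.trans
    (by rw [hr, map_zero]))
  rw [map_sub, sub_eq_zero] at h1 h2
  rw [h1, h2]
  exact RingHom.congr_fun h r

/-! ### Nilpotent lifting on coordinate rings and its consequences for completions -/

/-- The lifting property of `φ` for nilpotent extensions and homomorphisms that kill a power of
the ideal `m`. -/
def LiftsNilpotentAt {A B : Type u} [CommRing A] [CommRing B] (φ : A →+* B) (m : Ideal B) : Prop :=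
  ∀ (C : Type u) [CommRing C] (J : Ideal C) (N : ℕ), IsNilpotent J →
    ∀ (a : A →+* C) (b : B →+* C ⧸ J), (∀ r ∈ m.comap φ ^ N, a r = 0) → (∀ r ∈ m ^ N, b r = 0) →
      (Ideal.Quotient.mk J).comp a = b.comp φ →
      ∃ c : B →+* C, c.comp φ = a ∧ (Ideal.Quotient.mk J).comp c = b

/-- Write `n₀` for the contraction of `m`. As the residue rings agree, `B → B / m ≃ A / n₀` can be
lifted along the nilpotent extension `A / n₀ ^ n → A / n₀` to a map that extends the projection of
`A`. The lift sends `m` into `n₀ / n₀ ^ n`, hence kills `m ^ n`. -/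
theorem LiftsNilpotentAt.mem_pow_of_map_mem_pow {A B : Type u} [CommRing A] [CommRing B]
    {φ : A →+* B} {m : Ideal B} (H : LiftsNilpotentAt φ m) (hres : ∀ b : B, ∃ a, b - φ a ∈ m)
    (n : ℕ) {a : A} (ha : φ a ∈ m ^ n) : a ∈ m.comap φ ^ n := by
  let C := A ⧸ m.comap φ ^ n
  let J : Ideal C := (m.comap φ).map (Ideal.Quotient.mk _)
  have hJ : J ^ n = ⊥ := by rw [← Ideal.map_pow, Ideal.map_quotient_self]
  let π : A →+* B ⧸ m := (Ideal.Quotient.mk m).comp φ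
  have hπ : Function.Surjective π := by
    intro b
    obtain ⟨b, rfl⟩ := Ideal.Quotient.mk_surjective b
    obtain ⟨a, ha⟩ := hres b
    exact ⟨a, (Ideal.Quotient.eq.mpr ha).symm⟩
  let ρ : A →+* C ⧸ J := (Ideal.Quotient.mk J).comp (Ideal.Quotient.mk _)
  have hρ : RingHom.ker π ≤ RingHom.ker ρ := by
    intro a ha
    have ha' : φ a ∈ m := Ideal.Quotient.eq_zero_iff_mem.mp ha
    exact Ideal.Quotient.eq_zero_iff_mem.mpr (Ideal.mem_map_of_mem _ ha')
  let b : B →+* C ⧸ J := (π.liftOfSurjective hπ ⟨ρ, hρ⟩).comp (Ideal.Quotient.mk m)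
  have hbm : ∀ r ∈ m, b r = 0 := fun r hr => by
    simp only [b, RingHom.comp_apply]
    rw [Ideal.Quotient.eq_zero_iff_mem.mpr hr, map_zero]
  -- The exponent `n + 1` is positive even for `n = 0`, so that `m ^ (n + 1) ≤ m` is killed by `b`.
  obtain ⟨c, hc, hcb⟩ := H C J (n + 1) ⟨n, hJ⟩ (Ideal.Quotient.mk _) b
    (fun r hr => Ideal.Quotient.eq_zero_iff_mem.mpr (Ideal.pow_le_pow_right n.le_succ hr))
    (fun r hr => hbm r (Ideal.pow_le_self n.succ_ne_zero hr))
    (RingHom.ext fun a => (RingHom.liftOfRightInverse_comp_apply π _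
      (Function.rightInverse_surjInv hπ) ⟨ρ, hρ⟩ a).symm)
  have h1 : m.map c ≤ J := by
    rw [Ideal.map_le_iff_le_comap]
    intro r hr
    rw [Ideal.mem_comap, ← Ideal.Quotient.eq_zero_iff_mem]
    exact (RingHom.congr_fun hcb r).trans (hbm r hr)
  have h2 := Ideal.pow_right_mono h1 n (Ideal.map_pow c m n ▸ Ideal.mem_map_of_mem c ha)
  rw [hJ, ← RingHom.comp_apply, hc] at h2
  exact Ideal.Quotient.eq_zero_iff_mem.mp h2

/-- By induction the error lies in `m ^ n`, which is spanned over `B` by images from `A`. Replacing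
the coefficients in `B` by elements of `A` with the same residue costs only a term in `m ^ (n + 1)`.
-/
theorem exists_sub_map_mem_pow {A B : Type u} [CommRing A] [CommRing B] (φ : A →+* B) (m : Ideal B)
    (hres : ∀ b : B, ∃ a, b - φ a ∈ m) (hgen : m ≤ (m.comap φ).map φ) (n : ℕ) (b : B) :
    ∃ a, b - φ a ∈ m ^ n := by
  induction n generalizing b with
  | zero => exact ⟨0, by simp⟩
  | succ n ih =>
    obtain ⟨a, ha⟩ := ih b
    have key : ∀ t ∈ (m.comap φ ^ n).map φ, ∃ r, φ r ∈ m ^ n ∧ t - φ r ∈ m ^ (n + 1) := by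
      intro t ht
      induction ht using Submodule.span_induction with
      | mem t ht =>
        obtain ⟨r, hr, rfl⟩ := ht
        exact ⟨r, Ideal.le_comap_pow φ n hr, by simp⟩
      | zero => exact ⟨0, by simp⟩
      | add s t _ _ hs ht =>
        obtain ⟨r, hr, hrs⟩ := hs
        obtain ⟨r', hr', hrt⟩ := ht
        refine ⟨r + r', by rw [map_add]; exact add_mem hr hr', ?_⟩
        rw [map_add, add_sub_add_comm]
        exact add_mem hrs hrt
      | smul s t _ ht =>
        obtain ⟨r, hr, hrt⟩ := ht
        obtain ⟨r', hr'⟩ := hres s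
        refine ⟨r' * r, by rw [map_mul]; exact Ideal.mul_mem_left _ _ hr, ?_⟩
        have : s • t - φ (r' * r) = s * (t - φ r) + (s - φ r') * φ r := by
          rw [map_mul, smul_eq_mul]; ring
        rw [this]
        refine add_mem (Ideal.mul_mem_left _ _ hrt) ?_
        rw [pow_succ']
        exact Ideal.mul_mem_mul hr' hr
    obtain ⟨r, -, hr⟩ := key _ (Ideal.map_pow φ (m.comap φ) n ▸ Ideal.pow_right_mono hgen n ha)
    exact ⟨a + r, by rwa [map_add, ← sub_sub]⟩

/-- Continuous maps to discrete rings are maps from the coordinate ring that kill a power of the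
maximal ideal, so the topological lifting problem restricts to one on coordinate rings. Its solution
extends back to the completion. -/
theorem isTopFormallySmooth_completedStalkMap {X Y : Scheme.{u}} {R S : CommRingCat.{u}} (f : X ⟶ Y)
    (g : Y ⟶ Spec R) [IsOpenImmersion g] (h : X ⟶ Spec S) [IsOpenImmersion h] (φ : R ⟶ S)
    (w : f ≫ g = h ≫ Spec.map φ) (x : X) (q : PrimeSpectrum R) (p : PrimeSpectrum S)
    [q.asIdeal.IsMaximal] [p.asIdeal.IsMaximal] (hp : h x = p) (hq : g (f x) = q)
    (hqp : q.asIdeal = p.asIdeal.comap φ.hom) (H : LiftsNilpotentAt φ.hom p.asIdeal) :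
    IsTopFormallySmooth (completedStalkMap f x) := by
  intro C _ _ _ J _ _ hJ a b ha hb hab
  obtain ⟨n₁, h₁⟩ := CompletedStalk.exists_proj_of_continuous a ha
  obtain ⟨n₂, h₂⟩ := CompletedStalk.exists_proj_of_continuous b hb
  have hkill : ∀ r ∈ p.asIdeal ^ max n₁ n₂, b (chartCompletedStalk h x r) = 0 := fun r hr => h₂ _ <| by
    rw [proj_chartCompletedStalk, Ideal.Quotient.eq_zero_iff_mem,
      chartStalk_mem_maximalIdeal_pow h x p hp]
    exact Ideal.pow_le_pow_right (le_max_right _ _) hr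
  obtain ⟨c, hcφ, hcJ⟩ := H C J (max n₁ n₂) hJ (a.comp (chartCompletedStalk g (f x)))
    (b.comp (chartCompletedStalk h x))
    (fun r hr => h₁ _ <| by
      rw [proj_chartCompletedStalk, Ideal.Quotient.eq_zero_iff_mem,
        chartStalk_mem_maximalIdeal_pow g (f x) q hq, hqp]
      exact Ideal.pow_le_pow_right (le_max_left _ _) hr)
    hkill
    (by
      ext r
      have := RingHom.congr_fun hab (chartCompletedStalk g (f x) r)
      simp only [RingHom.comp_apply] at this ⊢
      rw [this, completedStalkMap_chartCompletedStalk f g h φ w])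
  obtain ⟨M, hM⟩ := hJ
  -- Continuity of the lift is automatic: `c` sends `p ^ max n₁ n₂` into `J`, and `J ^ M = 0`.
  have hc0 : ∀ r ∈ p.asIdeal ^ (max n₁ n₂ * M), c r = 0 := by
    intro r hr
    have h1 : (p.asIdeal ^ max n₁ n₂).map c ≤ J := by
      rw [Ideal.map_le_iff_le_comap]
      intro s hs
      rw [Ideal.mem_comap, ← Ideal.Quotient.eq_zero_iff_mem]
      exact (RingHom.congr_fun hcJ s).trans (hkill s hs)
    have h2 := Ideal.mem_map_of_mem c hr
    rw [pow_mul, Ideal.map_pow] at h2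
    simpa [hM] using Ideal.pow_right_mono h1 M h2
  obtain ⟨c', hc', hc'r⟩ := exists_completedStalk_lift h x p hp _ c hc0
  have hcont := CompletedStalk.continuous_of_proj c' _ hc'
  have hcr : c'.comp (chartCompletedStalk h x) = c :=
    RingHom.ext fun r => hc'r _ r (proj_chartCompletedStalk h x _ r)
  have hmap : Continuous (completedStalkMap f x) := by
    refine continuous_iInf_rng.mpr fun n => continuous_induced_rng.mpr ?_
    have : CompletedStalk.proj X x n ∘ completedStalkMap f x =
        ((stalkQuotientMap f x n).comp (CompletedStalk.proj Y (f x) n)) :=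
      funext fun a => proj_completedStalkMap f x n a
    rw [this]
    let : TopologicalSpace (X.presheaf.stalk x ⧸
        (IsLocalRing.maximalIdeal (X.presheaf.stalk x)) ^ n) := ⊥
    exact CompletedStalk.continuous_of_proj _ n fun a ha => by rw [RingHom.comp_apply, ha, map_zero]
  refine ⟨c', hcont, ?_, ?_⟩
  · refine CompletedStalk.ringHom_ext g (f x) q hq (c := c'.comp (completedStalkMap f x))
      (hcont.comp hmap) ha ?_
    rw [← hcφ, ← hcr]
    ext r
    exact congrArg c' (completedStalkMap_chartCompletedStalk f g h φ w x r)
  · refine CompletedStalk.ringHom_ext h x p hp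
      (c := (Ideal.Quotient.mk J).comp c')
      ((continuous_of_discreteTopology (f := Ideal.Quotient.mk J)).comp hcont) hb ?_
    rw [RingHom.comp_assoc, hcr, hcJ]

theorem isHomeomorph_completedStalkMap_of_lifts {X Y : Scheme.{u}} {R S : CommRingCat.{u}}
    (f : X ⟶ Y)
    (g : Y ⟶ Spec R) [IsOpenImmersion g] (h : X ⟶ Spec S) [IsOpenImmersion h] (φ : R ⟶ S)
    (w : f ≫ g = h ≫ Spec.map φ) (x : X) (q : PrimeSpectrum R) (p : PrimeSpectrum S)
    [q.asIdeal.IsMaximal] [p.asIdeal.IsMaximal] (hp : h x = p) (hq : g (f x) = q)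
    (hqp : q.asIdeal = p.asIdeal.comap φ.hom) (H : LiftsNilpotentAt φ.hom p.asIdeal)
    (hres : ∀ s : S, ∃ r : R, s - φ.hom r ∈ p.asIdeal)
    (hgen : p.asIdeal ≤ (p.asIdeal.comap φ.hom).map φ.hom) :
    IsHomeomorph (completedStalkMap f x) := by
  refine isHomeomorph_completedStalkMap f x fun n => ⟨?_, ?_⟩
  · rw [injective_iff_map_eq_zero]
    intro a ha
    obtain ⟨a, rfl⟩ := Ideal.Quotient.mk_surjective a
    obtain ⟨r, hr⟩ := exists_sub_chartStalk_mem g (f x) q hq n a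
    rw [Ideal.Quotient.eq.mpr hr] at ha ⊢
    have h1 : φ.hom r ∈ p.asIdeal ^ n := by
      rw [← chartStalk_mem_maximalIdeal_pow h x p hp, ← RingHom.comp_apply,
        ← stalkMap_comp_chartStalk f g h φ w, ← Ideal.Quotient.eq_zero_iff_mem]
      exact ha
    rw [Ideal.Quotient.eq_zero_iff_mem, chartStalk_mem_maximalIdeal_pow g (f x) q hq, hqp]
    exact H.mem_pow_of_map_mem_pow hres n h1
  · intro b
    obtain ⟨b, rfl⟩ := Ideal.Quotient.mk_surjective b
    obtain ⟨s, hs⟩ := exists_sub_chartStalk_mem h x p hp n b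
    obtain ⟨r, hr⟩ := exists_sub_map_mem_pow φ.hom p.asIdeal hres hgen n s
    refine ⟨Ideal.Quotient.mk _ (chartStalk g (f x) r), ?_⟩
    refine (Ideal.quotientMap_mk (I := IsLocalRing.maximalIdeal (X.presheaf.stalk x) ^ n)).trans ?_
    rw [eq_comm, Ideal.Quotient.eq, ← RingHom.comp_apply, stalkMap_comp_chartStalk f g h φ w]
    have h2 := add_mem hs ((chartStalk_mem_maximalIdeal_pow h x p hp n _).mpr hr)
    rwa [map_sub, sub_add_sub_cancel] at h2

/-! ### Sequential limits of smooth affine schemes -/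

theorem toSpecΓ_comp_SpecMap_inv_appTop {T : Scheme.{u}} {R : CommRingCat.{u}} (m : T ⟶ Spec R) :
    T.toSpecΓ ≫ Spec.map ((Scheme.ΓSpecIso R).inv ≫ m.appTop) = m := by
  rw [Spec.map_comp, ← Scheme.toSpecΓ_naturality_assoc, toSpecΓ_SpecMap_ΓSpecIso_inv,
    Category.comp_id]

/-- A cone of schemes over the `Spec (D n)` is a compatible family of maps from the `D n` to global
sections. Hence the ring-theoretic colimit property of `B` gives the limit property among all
schemes over `S`. -/
theorem isProSmooth_of_sequence {A B : CommRingCat.{u}} (φ : A ⟶ B) {S : Scheme.{u}}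
    (j : S ⟶ Spec A) [IsOpenImmersion j] (f : Spec B ⟶ S) (hf : f ≫ j = Spec.map φ)
    (D : ℕ → CommRingCat.{u}) (str : ∀ n, A ⟶ D n) (τ : ∀ n, D n ⟶ D (n + 1))
    (hτ : ∀ n, str n ≫ τ n = str (n + 1)) (ι : ∀ n, D n ⟶ B) (hι : ∀ n, τ n ≫ ι (n + 1) = ι n)
    (hstr : str 0 ≫ ι 0 = φ) (hsmooth : ∀ n, (str n).hom.Smooth)
    (hrange : ∀ n, Set.range (Spec.map (str n)) ⊆ Set.range j)
    (huniv : ∀ (C : CommRingCat.{u}) (g : ∀ n, D n ⟶ C), (∀ n, τ n ≫ g (n + 1) = g n) →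
      ∃! h : B ⟶ C, ∀ n, ι n ≫ h = g n) :
    IsProSmooth f := by
  have hstr' : ∀ n, str n ≫ ι n = φ := by
    intro n
    induction n with
    | zero => exact hstr
    | succ n ih => rw [← hτ, Category.assoc, hι, ih]
  let ℓ (n : ℕ) : Spec (D n) ⟶ S := IsOpenImmersion.lift j (Spec.map (str n)) (hrange n)
  have hℓ (n : ℕ) : ℓ n ≫ j = Spec.map (str n) := IsOpenImmersion.lift_fac _ _ _
  let X (n : ℕ) : Over S := Over.mk (ℓ n)
  let t (n : ℕ) : X (n + 1) ⟶ X n := Over.homMk (Spec.map (τ n)) (by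
    change Spec.map (τ n) ≫ ℓ n = ℓ (n + 1)
    rw [← cancel_mono j, Category.assoc, hℓ, hℓ, ← Spec.map_comp, hτ])
  let p (n : ℕ) : Over.mk f ⟶ X n := Over.homMk (Spec.map (ι n)) (by
    change Spec.map (ι n) ≫ ℓ n = f
    rw [← cancel_mono j, Category.assoc, hℓ, hf, ← Spec.map_comp, hstr'])
  have hp (n : ℕ) : p (n + 1) ≫ t n = p n := by
    ext1
    change Spec.map (ι (n + 1)) ≫ Spec.map (τ n) = Spec.map (ι n)
    rw [← Spec.map_comp, hι]
  let F : ℕᵒᵖ ⥤ Over S := Functor.ofOpSequence t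
  let c : Cone F :=
    { pt := Over.mk f
      π := NatTrans.ofOpSequence (fun n => p n) (fun n => by
        have h1 : F.map (homOfLE (Nat.le_add_right n 1)).op = t n :=
          Functor.ofOpSequence_map_homOfLE_succ t n
        rw [h1]
        exact (Category.id_comp (p n)).trans (hp n).symm) }
  have hc : IsLimit c := by
    have hs (s : Cone F) (n : ℕ) :
        s.π.app (Opposite.op (n + 1)) ≫ t n = s.π.app (Opposite.op n) := by
      rw [← Functor.ofOpSequence_map_homOfLE_succ t n]
      exact s.w _
    let l (s : Cone F) (n : ℕ) : s.pt.left ⟶ Spec (D n) := (s.π.app (Opposite.op n)).left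
    have hl (s : Cone F) (n : ℕ) : l s n = l s (n + 1) ≫ Spec.map (τ n) :=
      (congrArg CommaMorphism.left (hs s n)).symm
    let g (s : Cone F) (n : ℕ) : D n ⟶ Γ(s.pt.left, ⊤) :=
      (Scheme.ΓSpecIso (D n)).inv ≫ (l s n).appTop
    have hg (s : Cone F) (n : ℕ) : τ n ≫ g s (n + 1) = g s n := by
      simp only [g]
      rw [hl s n, Scheme.Hom.comp_appTop]
      exact Scheme.ΓSpecIso_inv_naturality_assoc _ _
    choose h hh hu using fun s => huniv _ (g s) (hg s)
    have hfac (s : Cone F) (n : ℕ) : (s.pt.left.toSpecΓ ≫ Spec.map (h s)) ≫ Spec.map (ι n) = l s n := by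
      rw [Category.assoc, ← Spec.map_comp, hh s n]
      exact toSpecΓ_comp_SpecMap_inv_appTop _
    exact
      { lift := fun s => Over.homMk (s.pt.left.toSpecΓ ≫ Spec.map (h s)) (by
          have h2 : f = Spec.map (ι 0) ≫ ℓ 0 := (Over.w (p 0)).symm
          change _ ≫ f = _
          rw [h2, ← Category.assoc, hfac]
          exact Over.w (s.π.app (Opposite.op 0)))
        fac := fun s n => by
          ext1
          exact hfac s n.unop
        uniq := fun s m hm => by
          ext1
          change m.left = s.pt.left.toSpecΓ ≫ Spec.map (h s)
          rw [← hu s ((Scheme.ΓSpecIso B).inv ≫ m.left.appTop) fun n => ?_]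
          · exact (toSpecΓ_comp_SpecMap_inv_appTop _).symm
          · simp only [g]
            rw [show l s n = m.left ≫ Spec.map (ι n) from
              (congrArg CommaMorphism.left (hm (Opposite.op n))).symm]
            rw [Scheme.Hom.comp_appTop, Scheme.ΓSpecIso_inv_naturality_assoc] }
  -- The index category has to live in the universe `u`.
  let E : AsSmall.{u} ℕᵒᵖ ⥤ Over S := AsSmall.down ⋙ F
  refine ⟨AsSmall.{u} ℕᵒᵖ, inferInstance, inferInstance, E, (c.whisker AsSmall.down).π, ?_, ?_, ⟨?_⟩⟩
  · intro i
    have hsm : Smooth (Spec.map (str (AsSmall.down.obj i).unop)) := by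
      rw [HasRingHomProperty.Spec_iff (P := @Smooth)]
      exact hsmooth _
    rw [← hℓ] at hsm
    -- As `j` is a monomorphism, `ℓ n` is the base change along `j` of the smooth map `ℓ n ≫ j`.
    have := MorphismProperty.IsStableUnderBaseChange.hasOfPostcompProperty_monomorphisms
      (P := @Smooth)
    exact MorphismProperty.of_postcomp (W := @Smooth)
      (W' := MorphismProperty.monomorphisms _) (ℓ (AsSmall.down.obj i).unop) j
      (MorphismProperty.monomorphisms.infer_property _) hsm
  · intro i i' φ
    have : ∀ i : ℕᵒᵖ, IsAffine (F.obj i).left := fun i => inferInstanceAs (IsAffine (Spec (D _)))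
    have h1 : IsAffine (E.obj i).left := this _
    have h2 : IsAffine (E.obj i').left := this _
    infer_instance
  · exact hc.whiskerEquivalence AsSmall.equiv.symm

section

/-! ### Division of power series -/

section Division

variable {R : Type*} [CommRing R]

/-- The power series of degree less than `n` with given coefficients. -/
def ofFin {n : ℕ} (v : Fin n → R) : R⟦X⟧ :=
  PowerSeries.mk fun m => if h : m < n then v ⟨m, h⟩ else 0

theorem coeff_ofFin {n : ℕ} (v : Fin n → R) (m : ℕ) :
    PowerSeries.coeff m (ofFin v) = if h : m < n then v ⟨m, h⟩ else 0 :=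
  PowerSeries.coeff_mk _ _

theorem coeff_ofFin_of_lt {n : ℕ} (v : Fin n → R) {m : ℕ} (h : m < n) :
    PowerSeries.coeff m (ofFin v) = v ⟨m, h⟩ := by
  rw [coeff_ofFin, dif_pos h]

theorem coeff_ofFin_of_le {n : ℕ} (v : Fin n → R) {m : ℕ} (h : n ≤ m) :
    PowerSeries.coeff m (ofFin v) = 0 := by
  rw [coeff_ofFin, dif_neg h.not_gt]

theorem ofFin_coeff {n : ℕ} (f : R⟦X⟧) (h : ∀ m, n ≤ m → PowerSeries.coeff m f = 0) :
    ofFin (fun i : Fin n => PowerSeries.coeff i f) = f := by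
  ext m
  rw [coeff_ofFin]
  split_ifs with hm
  · rfl
  · exact (h m (not_lt.mp hm)).symm

theorem map_ofFin {S : Type*} [CommRing S] (f : R →+* S) {n : ℕ} (v : Fin n → R) :
    PowerSeries.map f (ofFin v) = ofFin (f ∘ v) := by
  ext m
  rw [PowerSeries.coeff_map, coeff_ofFin, coeff_ofFin]
  split_ifs <;> simp

theorem ofFin_add {n : ℕ} (v v' : Fin n → R) : ofFin (v + v') = ofFin v + ofFin v' := by
  ext m
  rw [map_add]
  simp only [coeff_ofFin]
  split_ifs <;> simp

theorem ofFin_sub {n : ℕ} (v v' : Fin n → R) : ofFin (v - v') = ofFin v - ofFin v' := by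
  ext m
  rw [map_sub]
  simp only [coeff_ofFin]
  split_ifs <;> simp

theorem coeff_ofFin_mem {J : Ideal R} {n : ℕ} {v : Fin n → R} (h : ∀ i, v i ∈ J) (m : ℕ) :
    PowerSeries.coeff m (ofFin v) ∈ J := by
  rw [coeff_ofFin]
  split_ifs
  · exact h _
  · exact zero_mem _

theorem isNilpotent_of_le {I J : Ideal R} (hI : IsNilpotent I) (h : J ≤ I) : IsNilpotent J := by
  obtain ⟨n, hn⟩ := hI
  exact ⟨n, le_bot_iff.mp ((Ideal.pow_right_mono h n).trans hn.le)⟩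

theorem coe_sum_C_mul_X_pow {n : ℕ} (v : Fin n → R) :
    ((∑ i : Fin n, Polynomial.C (v i) * Polynomial.X ^ (i : ℕ) : R[X]) : R⟦X⟧) = ofFin v := by
  ext m
  rw [Polynomial.coeff_coe, coeff_ofFin, Polynomial.finsetSum_coeff]
  simp only [Polynomial.coeff_C_mul, Polynomial.coeff_X_pow, mul_ite, mul_one, mul_zero]
  split_ifs with h
  · rw [Finset.sum_eq_single ⟨m, h⟩]
    · simp
    · intro i _ hi
      rw [if_neg]
      rintro rfl
      exact hi rfl
    · simp
  · refine Finset.sum_eq_zero fun i _ => if_neg ?_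
    rintro rfl
    exact h i.2

theorem coeff_mul_mem {I J : Ideal R} {f g : R⟦X⟧} (hf : ∀ n, PowerSeries.coeff n f ∈ I)
    (hg : ∀ n, PowerSeries.coeff n g ∈ J) (n : ℕ) : PowerSeries.coeff n (f * g) ∈ I * J := by
  rw [PowerSeries.coeff_mul]
  exact Ideal.sum_mem _ fun _ _ => Ideal.mul_mem_mul (hf _) (hg _)

theorem coeff_mul_mem_right {J : Ideal R} (f : R⟦X⟧) {g : R⟦X⟧}
    (hg : ∀ n, PowerSeries.coeff n g ∈ J) (n : ℕ) : PowerSeries.coeff n (f * g) ∈ J := by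
  rw [PowerSeries.coeff_mul]
  exact Ideal.sum_mem _ fun _ _ => Ideal.mul_mem_left _ _ (hg _)

theorem coeff_mul_congr (q : R⟦X⟧) {f g : R⟦X⟧} {N : ℕ}
    (h : ∀ i < N, PowerSeries.coeff i f = PowerSeries.coeff i g) {i : ℕ} (hi : i < N) :
    PowerSeries.coeff i (q * f) = PowerSeries.coeff i (q * g) := by
  rw [PowerSeries.coeff_mul, PowerSeries.coeff_mul]
  refine Finset.sum_congr rfl fun x hx => ?_
  rw [h]
  have := Finset.HasAntidiagonal.mem_antidiagonal.mp hx
  omega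

/-- Divide by `X ^ e * w` in place of `q`: the remainder consists of the terms of `r` below degree
`e`, and the quotient is `w⁻¹` times the shifted tail. The error is the quotient times `q - X ^ e *
w`, whence the extra factor `I`. -/
theorem exists_approx_division {I K : Ideal R} {d e : ℕ} (he : e ≤ d) {q w : R⟦X⟧}
    (hw : IsUnit w) (hq : ∀ n, PowerSeries.coeff n (q - PowerSeries.X ^ e * w) ∈ I)
    (r : R⟦X⟧) (hr : ∀ n, PowerSeries.coeff n r ∈ K) :
    ∃ t ξ : R⟦X⟧, (∀ n, PowerSeries.coeff n t ∈ K) ∧ (∀ n, d ≤ n → PowerSeries.coeff n t = 0) ∧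
      (∀ n, PowerSeries.coeff n ξ ∈ K) ∧ ∀ n, PowerSeries.coeff n (r - (t + q * ξ)) ∈ I * K := by
  obtain ⟨w', hw'⟩ := hw.exists_right_inv
  obtain ⟨r', hr'⟩ : ∃ r' : R⟦X⟧, ∀ n, PowerSeries.coeff n r' = PowerSeries.coeff (n + e) r :=
    ⟨PowerSeries.mk fun n => PowerSeries.coeff (n + e) r, fun n => PowerSeries.coeff_mk _ _⟩
  have hξ : ∀ n, PowerSeries.coeff n (w' * r') ∈ K :=
    coeff_mul_mem_right _ fun n => by rw [hr']; exact hr _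
  have ht : ∀ n, PowerSeries.coeff n (r - PowerSeries.X ^ e * r') =
      if n < e then PowerSeries.coeff n r else 0 := by
    intro n
    rw [map_sub, PowerSeries.coeff_X_pow_mul', hr']
    split_ifs with h1 h2 h2
    · omega
    · rw [Nat.sub_add_cancel h1, sub_self]
    · rw [sub_zero]
    · omega
  refine ⟨r - PowerSeries.X ^ e * r', w' * r', fun n => ?_, fun n hn => ?_, hξ, fun n => ?_⟩
  · rw [ht]
    split_ifs
    · exact hr n
    · exact zero_mem _
  · rw [ht, if_neg (by omega)]
  · have : r - (r - PowerSeries.X ^ e * r' + q * (w' * r')) =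
        -((q - PowerSeries.X ^ e * w) * (w' * r')) := by
      linear_combination (-PowerSeries.X ^ e * r') * hw'
    rw [this, map_neg, neg_mem_iff]
    exact coeff_mul_mem hq hξ n

/-- Weierstrass division by a power series that is `X ^ e` times a unit up to a nilpotent ideal. -/
theorem exists_division {I : Ideal R} (hI : IsNilpotent I) {d e : ℕ} (he : e ≤ d) {q w : R⟦X⟧}
    (hw : IsUnit w) (hq : ∀ n, PowerSeries.coeff n (q - PowerSeries.X ^ e * w) ∈ I) (J : Ideal R)
    (f : R⟦X⟧) (hf : ∀ n, PowerSeries.coeff n f ∈ J) :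
    ∃ (v : Fin d → R) (ξ : R⟦X⟧), (∀ i, v i ∈ J) ∧ (∀ n, PowerSeries.coeff n ξ ∈ J) ∧
      ofFin v + q * ξ = f := by
  -- Dividing the error again and again moves it into `I ^ a * J`, which vanishes once `I ^ a = 0`.
  have key : ∀ a : ℕ, ∃ v ξ : R⟦X⟧, (∀ n, PowerSeries.coeff n v ∈ J) ∧
      (∀ n, d ≤ n → PowerSeries.coeff n v = 0) ∧ (∀ n, PowerSeries.coeff n ξ ∈ J) ∧
      ∀ n, PowerSeries.coeff n (f - (v + q * ξ)) ∈ I ^ a * J := by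
    intro a
    induction a with
    | zero => exact ⟨0, 0, by simp, by simp, by simp, by simpa using hf⟩
    | succ a ih =>
      obtain ⟨v, ξ, hv, hvd, hξ, hr⟩ := ih
      obtain ⟨t, η, ht, htd, hη, hs⟩ := exists_approx_division he hw hq _ hr
      have hle : I ^ a * J ≤ J := Ideal.mul_le_right
      refine ⟨v + t, ξ + η, fun n => ?_, fun n hn => ?_, fun n => ?_, fun n => ?_⟩
      · rw [map_add]
        exact add_mem (hv n) (hle (ht n))
      · rw [map_add, hvd n hn, htd n hn, add_zero]
      · rw [map_add]
        exact add_mem (hξ n) (hle (hη n))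
      · have : f - (v + t + q * (ξ + η)) = f - (v + q * ξ) - (t + q * η) := by ring
        rw [this, pow_succ', mul_assoc]
        exact hs n
  obtain ⟨a, ha⟩ := hI
  obtain ⟨v, ξ, hv, hvd, hξ, hr⟩ := key a
  refine ⟨fun i => PowerSeries.coeff i v, ξ, fun i => hv i, hξ, ?_⟩
  rw [ofFin_coeff v hvd, eq_comm, ← sub_eq_zero]
  ext n
  simpa [ha] using hr n

/-- Division by a monic polynomial, up to a given order. -/
theorem exists_division_of_monic {d : ℕ} (a : Fin d → R) (N : ℕ) (J : Ideal R)
    (f : R⟦X⟧) (hf : ∀ n, PowerSeries.coeff n f ∈ J) :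
    ∃ (v : Fin d → R) (ξ : R⟦X⟧), (∀ i, v i ∈ J) ∧ (∀ n, PowerSeries.coeff n ξ ∈ J) ∧
      ∀ n < N, PowerSeries.coeff n (ofFin v + (PowerSeries.X ^ d + ofFin a) * ξ) =
        PowerSeries.coeff n f := by
  nontriviality R
  let q : R[X] := Polynomial.X ^ d + ∑ i : Fin d, Polynomial.C (a i) * Polynomial.X ^ (i : ℕ)
  have hq : (q : R⟦X⟧) = PowerSeries.X ^ d + ofFin a := by
    rw [← coe_sum_C_mul_X_pow]
    simp [q]
  have hmonic : q.Monic := Polynomial.monic_X_pow_add (Polynomial.degree_sum_fin_lt a)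
  have hqdeg : q.degree = d := by
    rw [Polynomial.degree_add_eq_left_of_degree_lt, Polynomial.degree_X_pow]
    rw [Polynomial.degree_X_pow]
    exact Polynomial.degree_sum_fin_lt a
  -- Below order `N` only this polynomial matters, and Euclidean division by a monic polynomial is
  -- available over any ring.
  let p : R[X] := PowerSeries.trunc N f
  have hp : p.map (Ideal.Quotient.mk J) = 0 := by
    ext n
    rw [Polynomial.coeff_map, PowerSeries.coeff_trunc]
    split_ifs
    · exact Ideal.Quotient.eq_zero_iff_mem.mpr (hf n)
    · simp
  -- Division by a monic polynomial commutes with reduction modulo `J`, where `p` becomes 0.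
  have hmod : ∀ n, (p %ₘ q).coeff n ∈ J := fun n => by
    rw [← Ideal.Quotient.eq_zero_iff_mem, ← Polynomial.coeff_map, Polynomial.map_modByMonic _ hmonic,
      hp, Polynomial.zero_modByMonic, Polynomial.coeff_zero]
  have hdiv : ∀ n, (p /ₘ q).coeff n ∈ J := fun n => by
    rw [← Ideal.Quotient.eq_zero_iff_mem, ← Polynomial.coeff_map, Polynomial.map_divByMonic _ hmonic,
      hp, Polynomial.zero_divByMonic, Polynomial.coeff_zero]
  refine ⟨fun i => (p %ₘ q).coeff i, (p /ₘ q : R[X]), fun i => hmod i,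
    fun n => by rw [Polynomial.coeff_coe]; exact hdiv n, fun n hn => ?_⟩
  have h1 : ofFin (fun i : Fin d => (p %ₘ q).coeff i) = ((p %ₘ q : R[X]) : R⟦X⟧) := by
    rw [← ofFin_coeff (n := d) ((p %ₘ q : R[X]) : R⟦X⟧)]
    · simp only [Polynomial.coeff_coe]
    · intro m hm
      rw [Polynomial.coeff_coe]
      refine Polynomial.coeff_eq_zero_of_degree_lt ((Polynomial.degree_modByMonic_lt p hmonic).trans_le ?_)
      rw [hqdeg]
      exact_mod_cast hm
  rw [h1, ← hq, ← Polynomial.coe_mul, ← Polynomial.coe_add, Polynomial.modByMonic_add_div,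
    Polynomial.coeff_coe, PowerSeries.coeff_trunc, if_pos hn]

theorem isUnit_of_coeff_sub_mem {J : Ideal R} (hJ : IsNilpotent J) {u u' : R⟦X⟧} (hu : IsUnit u)
    (h : ∀ n, PowerSeries.coeff n (u' - u) ∈ J) : IsUnit u' := by
  rw [PowerSeries.isUnit_iff_constantCoeff] at hu ⊢
  have h0 : IsNilpotent (PowerSeries.constantCoeff (u' - u)) := by
    obtain ⟨n, hn⟩ := hJ
    refine ⟨n, ?_⟩
    have := Ideal.pow_mem_pow (h 0) n
    rw [hn] at this
    simpa using this
  have := h0.isUnit_add_left_of_commute hu (Commute.all _ _)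
  rwa [map_sub, add_sub_cancel] at this

/-- Deformation of a factorization into a monic polynomial and a unit. -/
theorem exists_factorization {I J : Ideal R} (hI : IsNilpotent I) (hJI : J ≤ I) {d e : ℕ}
    (he : e ≤ d) {w : R⟦X⟧} (hw : IsUnit w) (a : Fin d → R) (u : R⟦X⟧) (hu : IsUnit u)
    (hq : ∀ n, PowerSeries.coeff n (PowerSeries.X ^ d + ofFin a - PowerSeries.X ^ e * w) ∈ I)
    (f : R⟦X⟧) (hf : ∀ n, PowerSeries.coeff n (f - (PowerSeries.X ^ d + ofFin a) * u) ∈ J) :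
    ∃ (a' : Fin d → R) (u' : R⟦X⟧), (∀ i, a' i - a i ∈ J) ∧
      (∀ n, PowerSeries.coeff n (u' - u) ∈ J) ∧ IsUnit u' ∧
      (PowerSeries.X ^ d + ofFin a') * u' = f := by
  -- Newton iteration. With error `r = f - q u`, divide `u⁻¹ r = v + q ξ` and replace `(q, u)` by
  -- `(q + v, u + u ξ)`. The new error is `-v u ξ`, quadratic in the correction.
  have key : ∀ m : ℕ, ∃ (a' : Fin d → R) (u' : R⟦X⟧), (∀ i, a' i - a i ∈ J) ∧
      (∀ n, PowerSeries.coeff n (u' - u) ∈ J) ∧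
      ∀ n, PowerSeries.coeff n (f - (PowerSeries.X ^ d + ofFin a') * u') ∈ J ^ (m + 1) := by
    intro m
    induction m with
    | zero => exact ⟨a, u, by simp, by simp, by simpa using hf⟩
    | succ m ih =>
      obtain ⟨a', u', ha, hu', hr⟩ := ih
      obtain ⟨z, hz⟩ := (isUnit_of_coeff_sub_mem (isNilpotent_of_le hI hJI) hu hu').exists_right_inv
      -- The corrected polynomial differs from the original one by coefficients in `J ≤ I`, so
      -- division by it is still possible.
      have hq' : ∀ n, PowerSeries.coeff n
          (PowerSeries.X ^ d + ofFin a' - PowerSeries.X ^ e * w) ∈ I := fun n => by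
        have : PowerSeries.X ^ d + ofFin a' - PowerSeries.X ^ e * w =
            (PowerSeries.X ^ d + ofFin a - PowerSeries.X ^ e * w) + ofFin (a' - a) := by
          rw [ofFin_sub]; ring
        rw [this, map_add]
        exact add_mem (hq n) (hJI (coeff_ofFin_mem ha n))
      obtain ⟨v, ξ, hv, hξ, h⟩ := exists_division (q := PowerSeries.X ^ d + ofFin a') hI he hw
        hq' (J ^ (m + 1)) _ (coeff_mul_mem_right z hr)
      refine ⟨a' + v, u' + u' * ξ, fun i => ?_, fun n => ?_, fun n => ?_⟩
      · rw [Pi.add_apply, add_sub_right_comm]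
        exact add_mem (ha i) (Ideal.pow_le_self m.succ_ne_zero (hv i))
      · rw [add_sub_right_comm, map_add]
        exact add_mem (hu' n) (Ideal.pow_le_self m.succ_ne_zero (coeff_mul_mem_right _ hξ n))
      · have : f - (PowerSeries.X ^ d + ofFin (a' + v)) * (u' + u' * ξ) =
            - (ofFin v * (u' * ξ)) := by
          rw [ofFin_add]
          linear_combination (-u') * h + (f - (PowerSeries.X ^ d + ofFin a') * u') * (-hz)
        rw [this, map_neg, neg_mem_iff]
        have h1 := coeff_mul_mem (coeff_ofFin_mem hv) (coeff_mul_mem_right u' hξ) n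
        rw [← pow_add] at h1
        exact Ideal.pow_le_pow_right (by omega) h1
  have hJ : IsNilpotent J := isNilpotent_of_le hI hJI
  obtain ⟨m, hm⟩ := hJ
  obtain ⟨a', u', ha, hu', hr⟩ := key m
  refine ⟨a', u', ha, hu', isUnit_of_coeff_sub_mem ⟨m, hm⟩ hu hu', ?_⟩
  rw [eq_comm, ← sub_eq_zero]
  ext n
  simpa [pow_succ, hm] using hr n

end Division

end

section

/-! ### Smoothness of algebras given by generators and relations -/

section RelQuot

variable {A : Type u} [CommRing A] {σ τ : Type} (R : τ → MvPolynomial σ A)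

/-- The algebra with generators `σ` and relations `R`. -/
def RelQuot : Type u := MvPolynomial σ A ⧸ Ideal.span (Set.range R)

instance : CommRing (RelQuot R) :=
  inferInstanceAs (CommRing (MvPolynomial σ A ⧸ Ideal.span (Set.range R)))

instance : Algebra A (RelQuot R) :=
  inferInstanceAs (Algebra A (MvPolynomial σ A ⧸ Ideal.span (Set.range R)))

/-- The projection from the polynomial algebra. -/
def RelQuot.mk : MvPolynomial σ A →+* RelQuot R := Ideal.Quotient.mk (Ideal.span (Set.range R))

/-- The generators of `RelQuot R`. -/
def RelQuot.gen (s : σ) : RelQuot R := RelQuot.mk R (MvPolynomial.X s)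

variable {R}

theorem RelQuot.mk_surjective : Function.Surjective (RelQuot.mk R) := Ideal.Quotient.mk_surjective

theorem RelQuot.mk_eq :
    RelQuot.mk R = MvPolynomial.eval₂Hom (algebraMap A (RelQuot R)) (RelQuot.gen R) := by
  apply MvPolynomial.ringHom_ext
  · intro a
    rw [MvPolynomial.eval₂Hom_C]
    rfl
  · intro s
    rw [MvPolynomial.eval₂Hom_X']
    rfl

theorem RelQuot.map_eval {C : Type*} [CommRing C] (g : RelQuot R →+* C) (p : MvPolynomial σ A) :
    MvPolynomial.eval₂Hom (g.comp (algebraMap A (RelQuot R))) (g ∘ RelQuot.gen R) p =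
      g (MvPolynomial.eval₂Hom (algebraMap A (RelQuot R)) (RelQuot.gen R) p) :=
  (MvPolynomial.map_eval₂Hom _ _ _ _).symm

theorem RelQuot.eval_gen (t : τ) :
    MvPolynomial.eval₂Hom (algebraMap A (RelQuot R)) (RelQuot.gen R) (R t) = 0 := by
  rw [← RelQuot.mk_eq]
  exact Ideal.Quotient.eq_zero_iff_mem.mpr (Ideal.subset_span ⟨t, rfl⟩)

theorem RelQuot.hom_ext {C : Type*} [CommRing C] {g g' : RelQuot R →+* C}
    (hA : g.comp (algebraMap A (RelQuot R)) = g'.comp (algebraMap A (RelQuot R)))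
    (hX : ∀ s, g (RelQuot.gen R s) = g' (RelQuot.gen R s)) : g = g' := by
  apply RingHom.ext
  intro p
  obtain ⟨p, rfl⟩ := RelQuot.mk_surjective p
  rw [RelQuot.mk_eq, ← RelQuot.map_eval, ← RelQuot.map_eval, hA,
    show g ∘ RelQuot.gen R = g' ∘ RelQuot.gen R from funext hX]

theorem RelQuot.exists_lift {C : Type*} [CommRing C] (a : A →+* C) (x : σ → C)
    (h : ∀ t, MvPolynomial.eval₂Hom a x (R t) = 0) : ∃ g : RelQuot R →+* C,
      g.comp (algebraMap A (RelQuot R)) = a ∧ ∀ s, g (RelQuot.gen R s) = x s := by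
  have hker : Ideal.span (Set.range R) ≤ RingHom.ker (MvPolynomial.eval₂Hom a x) := by
    rw [Ideal.span_le]
    rintro _ ⟨t, rfl⟩
    exact h t
  have hker' : ∀ p ∈ Ideal.span (Set.range R), MvPolynomial.eval₂Hom a x p = 0 := fun p hp => hker hp
  refine ⟨Ideal.Quotient.lift _ (MvPolynomial.eval₂Hom a x) hker', ?_, fun s => ?_⟩
  · exact RingHom.ext fun r =>
      (Ideal.Quotient.lift_mk (Ideal.span (Set.range R)) _ hker').trans
        (MvPolynomial.eval₂Hom_C a x r)
  · exact (Ideal.Quotient.lift_mk (Ideal.span (Set.range R)) _ hker').trans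
      (MvPolynomial.eval₂Hom_X' a x s)

/-- Algebra maps out of `RelQuot R` are solutions of the equations, so formal smoothness says that a
solution modulo a square-zero ideal can be corrected to a solution. Finiteness of `σ` and `τ` gives
finite presentation. -/
theorem RelQuot.smooth [Finite σ] [Finite τ]
    (H : ∀ (C : Type u) [CommRing C] (a : A →+* C) (J : Ideal C), J ^ 2 = ⊥ → ∀ x : σ → C,
      (∀ t, MvPolynomial.eval₂Hom a x (R t) ∈ J) →
        ∃ y : σ → C, (∀ s, y s - x s ∈ J) ∧ ∀ t, MvPolynomial.eval₂Hom a y (R t) = 0) :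
    Algebra.Smooth A (RelQuot R) := by
  have : Algebra.FinitePresentation A (RelQuot R) :=
    Algebra.FinitePresentation.quotient (Submodule.fg_span (Set.finite_range R))
  refine { formallySmooth := ?_, finitePresentation := this }
  rw [Algebra.FormallySmooth.iff_comp_surjective]
  intro C _ _ J hJ g
  choose x hx using fun s => Ideal.Quotient.mk_surjective (g (RelQuot.gen R s))
  have hgA : (g : RelQuot R →+* C ⧸ J).comp (algebraMap A (RelQuot R)) =
      (Ideal.Quotient.mk J).comp (algebraMap A C) := RingHom.ext g.commutes
  obtain ⟨y, hy, hR⟩ := H C (algebraMap A C) J hJ x fun t => by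
    have h1 := RelQuot.map_eval (g : RelQuot R →+* C ⧸ J) (R t)
    rw [RelQuot.eval_gen, map_zero, hgA] at h1
    rw [← Ideal.Quotient.eq_zero_iff_mem, MvPolynomial.map_eval₂Hom, ← h1]
    congr 2
    exact funext hx
  obtain ⟨c, hcA, hc⟩ := RelQuot.exists_lift (algebraMap A C) y hR
  refine ⟨{ c with commutes' := RingHom.congr_fun hcA }, ?_⟩
  apply AlgHom.coe_ringHom_injective
  refine RelQuot.hom_ext ?_ fun s => ?_
  · rw [hgA]
    exact congrArg (Ideal.Quotient.mk J).comp hcA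
  · refine Eq.trans ?_ (hx s)
    change Ideal.Quotient.mk J (c _) = _
    rw [hc, Ideal.Quotient.eq]
    exact hy s

end RelQuot

/-- The stages are the algebras of truncated solutions, with the fixed unknowns `σ` and the first `c
+ n` coordinates. By `hR`, the equations of one stage are among those of the next, which gives the
transition maps. By `huniv` and `hext`, `B` classifies solutions of all the equations at once, so it
is the colimit. By `hrange`, every stage maps into the open subscheme `S`. -/
theorem isProSmooth_of_presentation {A B : CommRingCat.{u}} (φ : A ⟶ B) {S : Scheme.{u}}
    (j : S ⟶ Spec A) [IsOpenImmersion j] (f : Spec B ⟶ S) (hf : f ≫ j = Spec.map φ)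
    {σ τ : Type} [Finite σ] [Finite τ] (c : ℕ)
    (R : ∀ n, τ ⊕ Fin (c + n) → MvPolynomial (σ ⊕ Fin (c + n)) A)
    (hR : ∀ n t, MvPolynomial.rename (Sum.map id Fin.castSucc) (R n t) =
      R (n + 1) (Sum.map id Fin.castSucc t))
    (hsmooth : ∀ n (C : Type u) [CommRing C] (a : A →+* C) (J : Ideal C), J ^ 2 = ⊥ →
      ∀ x : σ ⊕ Fin (c + n) → C, (∀ t, MvPolynomial.eval₂Hom a x (R n t) ∈ J) →
        ∃ y : σ ⊕ Fin (c + n) → C, (∀ s, y s - x s ∈ J) ∧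
          ∀ t, MvPolynomial.eval₂Hom a y (R n t) = 0)
    (hrange : ∀ n (C : Type u) [CommRing C] (a : A →+* C) (x : σ ⊕ Fin (c + n) → C),
      (∀ t, MvPolynomial.eval₂Hom a x (R n t) = 0) →
        Set.range (Spec.map (CommRingCat.ofHom a)) ⊆ Set.range j)
    (b : σ ⊕ ℕ → B)
    (hb : ∀ n t, MvPolynomial.eval₂Hom φ.hom (b ∘ Sum.map id Fin.val) (R n t) = 0)
    (huniv : ∀ (C : Type u) [CommRing C] (a : A →+* C) (x : σ ⊕ ℕ → C),
      (∀ n t, MvPolynomial.eval₂Hom a (x ∘ Sum.map id Fin.val) (R n t) = 0) →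
        ∃ h : B →+* C, h.comp φ.hom = a ∧ ∀ s, h (b s) = x s)
    (hext : ∀ (C : Type u) [CommRing C] (h h' : B →+* C), h.comp φ.hom = h'.comp φ.hom →
      (∀ s, h (b s) = h' (b s)) → h = h') :
    IsProSmooth f := by
  choose ι hιA hιX using fun n => RelQuot.exists_lift φ.hom (b ∘ Sum.map id Fin.val) (hb n)
  have hτex (n : ℕ) := RelQuot.exists_lift (R := R n) (algebraMap A (RelQuot (R (n + 1))))
    (RelQuot.gen (R (n + 1)) ∘ Sum.map id Fin.castSucc) fun t => by
      have h1 := RelQuot.eval_gen (R := R (n + 1)) (Sum.map id Fin.castSucc t)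
      rwa [← hR, MvPolynomial.coe_eval₂Hom, MvPolynomial.eval₂_rename] at h1
  choose τ' hτA hτX using hτex
  refine isProSmooth_of_sequence φ j f hf (fun n => CommRingCat.of (RelQuot (R n)))
    (fun n => CommRingCat.ofHom (algebraMap A (RelQuot (R n)))) (fun n => CommRingCat.ofHom (τ' n))
    (fun n => ?_) (fun n => CommRingCat.ofHom (ι n)) (fun n => ?_) ?_ (fun n => ?_) (fun n => ?_) ?_
  · rw [← CommRingCat.ofHom_comp, hτA]
  · rw [← CommRingCat.ofHom_comp]
    congr 1
    refine RelQuot.hom_ext ?_ fun s => ?_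
    · rw [RingHom.comp_assoc, hτA, hιA, hιA]
    · rw [RingHom.comp_apply, hτX, hιX, Function.comp_apply, hιX]
      rcases s with s | s <;> rfl
  · rw [← CommRingCat.ofHom_comp, hιA]
    rfl
  · have := RelQuot.smooth (hsmooth n)
    exact RingHom.smooth_algebraMap.mpr this
  · exact hrange n _ _ (RelQuot.gen (R n)) RelQuot.eval_gen
  · intro C g hg
    have hg' (n) : (g (n + 1)).hom.comp (τ' n) = (g n).hom := by
      rw [← hg n]
      rfl
    have hgX (n s) : (g n).hom (RelQuot.gen (R n) s) =
        (g (n + 1)).hom (RelQuot.gen (R (n + 1)) (Sum.map id Fin.castSucc s)) := by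
      rw [← hg', RingHom.comp_apply, hτX]
      rfl
    have hgA (n) : (g n).hom.comp (algebraMap A (RelQuot (R n))) =
        (g 0).hom.comp (algebraMap A (RelQuot (R 0))) := by
      induction n with
      | zero => rfl
      | succ n ih => rw [← ih, ← hg' n, RingHom.comp_assoc, hτA]
    have hinl (n s) : (g n).hom (RelQuot.gen (R n) (Sum.inl s)) =
        (g 0).hom (RelQuot.gen (R 0) (Sum.inl s)) := by
      induction n with
      | zero => rfl
      | succ n ih => exact (hgX n (Sum.inl s)).symm.trans ih
    have hinr (n m : ℕ) (hnm : n ≤ m) (i : ℕ) (hi : i < c + n) (hi' : i < c + m) :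
        (g n).hom (RelQuot.gen (R n) (Sum.inr ⟨i, hi⟩)) =
        (g m).hom (RelQuot.gen (R m) (Sum.inr ⟨i, hi'⟩)) := by
      induction m, hnm using Nat.le_induction with
      | base => rfl
      | succ m hm ih => exact (ih (by omega)).trans (hgX m (Sum.inr ⟨i, by omega⟩))
    -- Coordinate `i` is read off at stage `i + 1`, where it exists whatever `c` is. By
    -- compatibility any later stage gives the same value.
    let x : σ ⊕ ℕ → C := Sum.elim (fun s => (g 0).hom (RelQuot.gen (R 0) (Sum.inl s)))
      (fun i => (g (i + 1)).hom (RelQuot.gen (R (i + 1)) (Sum.inr ⟨i, by omega⟩)))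
    have hx (n s) : (g n).hom (RelQuot.gen (R n) s) = x (Sum.map id Fin.val s) := by
      rcases s with s | ⟨i, hi⟩
      · exact hinl n s
      · exact (hinr n (max n (i + 1)) (le_max_left _ _) i hi (by omega)).trans
          (hinr (i + 1) (max n (i + 1)) (le_max_right _ _) i (by omega) (by omega)).symm
    obtain ⟨h, hhA, hhx⟩ := huniv C ((g 0).hom.comp (algebraMap A (RelQuot (R 0)))) x fun n t => by
      rw [← hgA n, ← show (g n).hom ∘ RelQuot.gen (R n) = x ∘ Sum.map id Fin.val from
        funext fun s => hx n s, RelQuot.map_eval, RelQuot.eval_gen, map_zero]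
    refine ⟨CommRingCat.ofHom h, fun n => ?_, fun h' hh' => ?_⟩
    · ext1
      refine RelQuot.hom_ext ?_ fun s => ?_
      · change (h.comp (ι n)).comp _ = _
        rw [RingHom.comp_assoc, hιA, hhA]
        exact (hgA n).symm
      · refine (congrArg h (hιX n s)).trans ((hhx _).trans (hx n s).symm)
    · ext1
      have hh'' (n) : h'.hom.comp (ι n) = (g n).hom := by
        rw [← hh' n]
        rfl
      refine hext C _ _ ?_ fun s => ?_
      · change _ = h.comp φ.hom
        rw [hhA, ← hh'', RingHom.comp_assoc, hιA]
      · refine Eq.trans ?_ (hhx s).symm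
        rcases s with s | i
        · refine (congrArg h'.hom (hιX 0 (Sum.inl s)).symm).trans ?_
          exact RingHom.congr_fun (hh'' 0) _
        · have := hιX (i + 1) (Sum.inr ⟨i, by omega⟩)
          refine (congrArg h'.hom this.symm).trans ?_
          exact RingHom.congr_fun (hh'' (i + 1)) _

end

section

/-! ### Lifting power series along nilpotent extensions -/

section Lifting

variable {C : Type*} [CommRing C] {J : Ideal C}

theorem map_mk_eq_map_mk_iff {f g : C⟦X⟧} :
    PowerSeries.map (Ideal.Quotient.mk J) f = PowerSeries.map (Ideal.Quotient.mk J) g ↔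
      ∀ n, PowerSeries.coeff n (f - g) ∈ J := by
  simp only [PowerSeries.ext_iff, PowerSeries.coeff_map, map_sub, Ideal.Quotient.eq]

theorem exists_map_mk_eq (g : (C ⧸ J)⟦X⟧) : ∃ f : C⟦X⟧, PowerSeries.map (Ideal.Quotient.mk J) f = g := by
  choose c hc using fun n => Ideal.Quotient.mk_surjective (PowerSeries.coeff n g)
  refine ⟨PowerSeries.mk c, ?_⟩
  ext n
  rw [PowerSeries.coeff_map, PowerSeries.coeff_mk, hc]

theorem isUnit_of_isUnit_map_mk (hJ : IsNilpotent J) {u : C⟦X⟧}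
    (hu : IsUnit (PowerSeries.map (Ideal.Quotient.mk J) u)) : IsUnit u := by
  obtain ⟨z, hz⟩ := hu.exists_right_inv
  obtain ⟨z, rfl⟩ := exists_map_mk_eq z
  rw [← map_mul, ← map_one (PowerSeries.map (Ideal.Quotient.mk J)), map_mk_eq_map_mk_iff] at hz
  exact isUnit_of_mul_isUnit_left (isUnit_of_coeff_sub_mem hJ isUnit_one hz)

/-- Take the preimage in `C` of the ideal generated by `b (ker e)`. Its `N`-th power lies in `J`, so
it is nilpotent. Modulo this ideal, any lift of `b r` is the constant `e r`. -/
theorem exists_nilpotent_ideal {k B : Type*} [Field k] [CommRing B] [Algebra k B] (e : B →+* k)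
    (he : e.comp (algebraMap k B) = RingHom.id k) (hJ : IsNilpotent J) (b : B →+* C ⧸ J) (N : ℕ)
    (hb : ∀ r ∈ RingHom.ker e ^ N, b r = 0) (s : k →+* C)
    (hs : (Ideal.Quotient.mk J).comp s = b.comp (algebraMap k B)) :
    ∃ I : Ideal C, IsNilpotent I ∧ J ≤ I ∧
      ∀ r c, Ideal.Quotient.mk J c = b r → c - s (e r) ∈ I := by
  refine ⟨((RingHom.ker e).map b).comap (Ideal.Quotient.mk J), ?_, ?_, fun r c h => ?_⟩
  · obtain ⟨M, hM⟩ := hJ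
    refine ⟨N * M, ?_⟩
    have h1 : (RingHom.ker e).map b ^ N = ⊥ := by
      rw [← Ideal.map_pow, ← le_bot_iff, Ideal.map_le_iff_le_comap]
      exact fun r hr => hb r hr
    have h2 := Ideal.le_comap_pow (K := (RingHom.ker e).map b) (Ideal.Quotient.mk J) N
    rw [h1, ← RingHom.ker_eq_comap_bot, Ideal.mk_ker] at h2
    rw [pow_mul]
    exact le_bot_iff.mp ((Ideal.pow_right_mono h2 M).trans hM.le)
  · intro c hc
    rw [Ideal.mem_comap, Ideal.Quotient.eq_zero_iff_mem.mpr hc]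
    exact zero_mem _
  · rw [Ideal.mem_comap, map_sub, h, ← RingHom.comp_apply, hs, RingHom.comp_apply, ← map_sub]
    refine Ideal.mem_map_of_mem b ?_
    rw [RingHom.mem_ker, map_sub, ← RingHom.comp_apply e, he, RingHom.id_apply, sub_self]

end Lifting

theorem exists_X_pow_mul_isUnit {K : Type*} [Field K] (f : K⟦X⟧) (d : ℕ)
    (hd : ∃ n ≤ d, PowerSeries.coeff n f ≠ 0) :
    ∃ e ≤ d, ∃ w : K⟦X⟧, IsUnit w ∧ f = PowerSeries.X ^ e * w := by
  classical
  obtain ⟨n, hn, hf⟩ := hd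
  have hex : ∃ n, PowerSeries.coeff n f ≠ 0 := ⟨n, hf⟩
  refine ⟨Nat.find hex, (Nat.find_min' hex hf).trans hn,
    PowerSeries.mk fun n => PowerSeries.coeff (n + Nat.find hex) f, ?_, ?_⟩
  · rw [PowerSeries.isUnit_iff_constantCoeff, ← PowerSeries.coeff_zero_eq_constantCoeff_apply,
      PowerSeries.coeff_mk, zero_add]
    exact (Nat.find_spec hex).isUnit
  · ext m
    rw [PowerSeries.coeff_X_pow_mul', PowerSeries.coeff_mk]
    split_ifs with h
    · rw [Nat.sub_add_cancel h]
    · exact not_not.mp (Nat.find_min hex (not_le.mp h))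

theorem coeff_X_pow_add_ofFin {R : Type*} [CommRing R] {d : ℕ} (a : Fin d → R) :
    PowerSeries.coeff d (PowerSeries.X ^ d + ofFin a : R⟦X⟧) = 1 := by
  rw [map_add, PowerSeries.coeff_X_pow_self, coeff_ofFin_of_le _ le_rfl, add_zero]

theorem X_pow_add_ofFin_injective {R : Type*} [CommRing R] {d : ℕ} {a a' : Fin d → R}
    (h : (PowerSeries.X ^ d + ofFin a : R⟦X⟧) = PowerSeries.X ^ d + ofFin a') : a = a' := by
  funext i
  have := congrArg (PowerSeries.coeff (i : ℕ)) (add_left_cancel h)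
  rwa [coeff_ofFin_of_lt _ i.2, coeff_ofFin_of_lt _ i.2] at this

theorem map_X_pow_add_ofFin {R S : Type*} [CommRing R] [CommRing S] (f : R →+* S) {d : ℕ}
    (a : Fin d → R) : PowerSeries.map f (PowerSeries.X ^ d + ofFin a) =
      PowerSeries.X ^ d + ofFin (f ∘ a) := by
  rw [map_add, map_pow, PowerSeries.map_X, map_ofFin]

/-! ### Universal properties of the coordinate rings -/

variable (k : Type u) [Field k]

theorem coe_univMonic (d : ℕ) : ((univMonic k d : (QRing k d)[X]) : (QRing k d)⟦X⟧) =
    PowerSeries.X ^ d + ofFin MvPolynomial.X := by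
  rw [univMonic, Polynomial.coe_add, coe_sum_C_mul_X_pow]
  simp

theorem coe_univPoly (d : ℕ) : ((univPoly k d : (ARing k d)[X]) : (ARing k d)⟦X⟧) =
    ofFin MvPolynomial.X := by
  rw [univPoly, coe_sum_C_mul_X_pow]

theorem coe_map_polynomial {R S : Type*} [CommRing R] [CommRing S] (f : R →+* S) (p : R[X]) :
    ((p.map f : S[X]) : S⟦X⟧) = PowerSeries.map f (p : R⟦X⟧) := by
  ext n
  simp

variable {k}

theorem map_classify_univArc {R : Type u} [CommRing R] [Algebra k R] (f : R⟦X⟧) :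
    PowerSeries.map (classify (k := k) f).toRingHom (univArc k) = f := by
  ext n
  simp [univArc, classify]

theorem LA1Ring.hom_ext {C : Type*} [CommRing C] {g g' : LA1Ring k →+* C}
    (hk : g.comp (algebraMap k _) = g'.comp (algebraMap k _))
    (hX : PowerSeries.map g (univArc k) = PowerSeries.map g' (univArc k)) : g = g' := by
  apply MvPolynomial.ringHom_ext
  · exact fun r => RingHom.congr_fun hk r
  · intro n
    simpa [univArc] using congrArg (PowerSeries.coeff n) hX

/-! ### The universal pair `(q, u)` and the deformation of factorizations -/

section Alpha

variable (k) (d : ℕ)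

/-- The coefficients of the universal monic polynomial. -/
def alphaCoeff (i : Fin d) : AlphaRing k d :=
  (Algebra.TensorProduct.includeLeft : QRing k d →ₐ[k] AlphaRing k d) (MvPolynomial.X i)

theorem coe_alphaPoly : ((alphaPoly k d : (AlphaRing k d)[X]) : (AlphaRing k d)⟦X⟧) =
    PowerSeries.X ^ d + ofFin (alphaCoeff k d) := by
  rw [alphaPoly, coe_map_polynomial, coe_univMonic, map_X_pow_add_ofFin]
  rfl

theorem isUnit_alphaUnit : IsUnit (alphaUnit k d) := (isUnit_univUnit k).map _

variable {k d}

theorem AlphaRing.exists_hom {C : Type u} [CommRing C] (s : k →+* C) (a : Fin d → C) (u : C⟦X⟧)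
    (hu : IsUnit u) : ∃ c : AlphaRing k d →+* C, c.comp (algebraMap k _) = s ∧
      (∀ i, c (alphaCoeff k d i) = a i) ∧ PowerSeries.map c (alphaUnit k d) = u := by
  let := s.toAlgebra
  obtain ⟨ψ, hψ, -⟩ := existsUnique_classify_unit (k := k) u hu
  let c : AlphaRing k d →ₐ[k] C := Algebra.TensorProduct.productMap (MvPolynomial.aeval a) ψ
  refine ⟨c.toRingHom, c.comp_algebraMap, fun i => ?_, ?_⟩
  · have : c (alphaCoeff k d i) = MvPolynomial.aeval a (MvPolynomial.X i) :=
      Algebra.TensorProduct.productMap_left_apply _ _ _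
    rwa [MvPolynomial.aeval_X] at this
  · rw [← hψ]
    ext n
    simp only [alphaUnit, PowerSeries.coeff_map]
    exact Algebra.TensorProduct.productMap_right_apply _ _ _

theorem AlphaRing.hom_ext {C : Type u} [CommRing C] {c c' : AlphaRing k d →+* C}
    (hk : c.comp (algebraMap k _) = c'.comp (algebraMap k _))
    (ha : ∀ i, c (alphaCoeff k d i) = c' (alphaCoeff k d i))
    (hu : PowerSeries.map c (alphaUnit k d) = PowerSeries.map c' (alphaUnit k d)) : c = c' := by
  let := (c.comp (algebraMap k (AlphaRing k d))).toAlgebra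
  let c₁ : AlphaRing k d →ₐ[k] C := { c with commutes' := fun r => rfl }
  let c₂ : AlphaRing k d →ₐ[k] C :=
    { c' with commutes' := fun r => (RingHom.congr_fun hk r).symm }
  suffices h : c₁ = c₂ from congrArg AlgHom.toRingHom h
  apply Algebra.TensorProduct.ext
  · exact MvPolynomial.algHom_ext ha
  · have hunit : IsUnit (PowerSeries.map c (alphaUnit k d)) := (isUnit_alphaUnit k d).map _
    refine (existsUnique_classify_unit (k := k) _ hunit).unique ?_ ?_
    · ext n
      simp only [alphaUnit, PowerSeries.coeff_map]
      rfl
    · rw [hu]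
      ext n
      simp only [alphaUnit, PowerSeries.coeff_map]
      rfl

theorem map_coe_alphaPoly {C : Type*} [CommRing C] (c : AlphaRing k d →+* C) :
    PowerSeries.map c ((alphaPoly k d : (AlphaRing k d)[X]) : (AlphaRing k d)⟦X⟧) =
      PowerSeries.X ^ d + ofFin (c ∘ alphaCoeff k d) := by
  rw [coe_alphaPoly, map_X_pow_add_ofFin]

variable (k d) in
/-- The comorphism of `(q, u) ↦ q u`. -/
def alphaComorphism : LA1Ring k →ₐ[k] AlphaRing k d :=
  classify ((alphaPoly k d : (AlphaRing k d)⟦X⟧) * alphaUnit k d)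

theorem map_alphaComorphism {C : Type*} [CommRing C] (c : AlphaRing k d →+* C) :
    PowerSeries.map (c.comp (alphaComorphism k d).toRingHom) (univArc k) =
      (PowerSeries.X ^ d + ofFin (c ∘ alphaCoeff k d)) * PowerSeries.map c (alphaUnit k d) := by
  rw [PowerSeries.map_comp, RingHom.comp_apply, alphaComorphism, map_classify_univArc, map_mul,
    map_coe_alphaPoly]

/-- A lifting problem consists of a series `f` over `C` and a factorization `q u` of its reduction
modulo `J`. At the base point `q` is a power of `X`, of exponent at most `d`, times a unit, and this
persists over `C` modulo a nilpotent ideal. Hence `exists_factorization` applies. -/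
theorem liftsNilpotentAt_alphaComorphism (e : AlphaRing k d →+* k)
    (he : e.comp (algebraMap k _) = RingHom.id k) :
    LiftsNilpotentAt (alphaComorphism k d).toRingHom (RingHom.ker e) := by
  intro C _ J N hJ a b _ hb hab
  let s : k →+* C := a.comp (algebraMap k (LA1Ring k))
  have hs : (Ideal.Quotient.mk J).comp s = b.comp (algebraMap k _) := by
    rw [← RingHom.comp_assoc, hab, RingHom.comp_assoc]
    exact congrArg b.comp (alphaComorphism k d).comp_algebraMap
  obtain ⟨I, hI, hJI, hmem⟩ := exists_nilpotent_ideal e he hJ b N hb s hs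
  obtain ⟨i, hi, w, hw, hq⟩ := exists_X_pow_mul_isUnit
    (PowerSeries.X ^ d + ofFin (e ∘ alphaCoeff k d)) d
    ⟨d, le_rfl, by rw [coeff_X_pow_add_ofFin]; exact one_ne_zero⟩
  -- Coefficients of `q` and `u` are lifted arbitrarily; the product then equals `f` only modulo
  -- `J`.
  choose a₀ ha₀ using fun i => Ideal.Quotient.mk_surjective (b (alphaCoeff k d i))
  obtain ⟨u₀, hu₀⟩ := exists_map_mk_eq (PowerSeries.map b (alphaUnit k d))
  have hu₀' : IsUnit u₀ := isUnit_of_isUnit_map_mk hJ (hu₀ ▸ (isUnit_alphaUnit k d).map _)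
  have hq₀ : ∀ n, PowerSeries.coeff n
      (PowerSeries.X ^ d + ofFin a₀ - PowerSeries.X ^ i * PowerSeries.map s w) ∈ I := by
    have h1 : PowerSeries.X ^ i * PowerSeries.map s w =
        PowerSeries.X ^ d + ofFin (s ∘ e ∘ alphaCoeff k d) := by
      rw [← map_X_pow_add_ofFin, hq, map_mul, map_pow, PowerSeries.map_X]
    rw [h1, add_sub_add_left_eq_sub, ← ofFin_sub]
    exact coeff_ofFin_mem fun i => hmem _ _ (ha₀ i)
  have hmk : ∀ a' : Fin d → C, (∀ i, a' i - a₀ i ∈ J) →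
      ∀ i, Ideal.Quotient.mk J (a' i) = b (alphaCoeff k d i) := fun a' h i => by
    rw [← ha₀]
    exact Ideal.Quotient.eq.mpr (h i)
  obtain ⟨a', u', ha', hu', hunit, hfac⟩ := exists_factorization hI hJI hi (hw.map _) a₀ u₀ hu₀' hq₀
    (PowerSeries.map a (univArc k)) <| by
      rw [← map_mk_eq_map_mk_iff, ← RingHom.comp_apply, ← PowerSeries.map_comp, hab,
        map_alphaComorphism, map_mul, map_X_pow_add_ofFin, hu₀]
      congr 3
      exact (funext ha₀).symm
  obtain ⟨c, hck, hca, hcu⟩ := AlphaRing.exists_hom s a' u' hunit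
  refine ⟨c, ?_, ?_⟩
  · apply LA1Ring.hom_ext
    · rw [RingHom.comp_assoc]
      exact (congrArg c.comp (alphaComorphism k d).comp_algebraMap).trans hck
    · rw [map_alphaComorphism, hcu, ← hfac, show c ∘ alphaCoeff k d = a' from funext hca]
  · apply AlphaRing.hom_ext
    · rw [RingHom.comp_assoc, hck, hs]
    · intro i
      rw [RingHom.comp_apply, hca, hmk a' ha']
    · rw [PowerSeries.map_comp, RingHom.comp_apply, hcu, ← hu₀]
      exact map_mk_eq_map_mk_iff.mpr hu'

end Alpha

end

section

/-! ### Points of affine schemes -/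

section Points

variable {k : Type u} [Field k] {A B : Type u} [CommRing A] [Algebra k A] [CommRing B] [Algebra k B]

variable (k B) in
/-- The identification of the affine `k`-scheme of `B` with `Spec B`. -/
def affineChart : (affine k B).left ⟶ Spec (CommRingCat.of B) := 𝟙 (Spec (CommRingCat.of B))

instance : IsOpenImmersion (affineChart k B) :=
  inferInstanceAs (IsOpenImmersion (𝟙 (Spec (CommRingCat.of B))))

theorem KPoint.left_eq (x : KPoint (affine k B)) :
    x.left = Spec.map (CommRingCat.ofHom (evalAt k x)) :=
  (Spec.map_preimage (show Spec (CommRingCat.of k) ⟶ Spec (CommRingCat.of B) from x.left)).symm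

theorem evalAt_comp_algebraMap (x : KPoint (affine k B)) :
    (evalAt k x).comp (algebraMap k B) = RingHom.id k := by
  have h : x.left ≫ Spec.map (CommRingCat.ofHom (algebraMap k B)) =
      𝟙 (Spec (CommRingCat.of k)) := Over.w x
  rw [KPoint.left_eq] at h
  have h' : Spec.map (CommRingCat.ofHom (algebraMap k B) ≫ CommRingCat.ofHom (evalAt k x)) =
      Spec.map (𝟙 (CommRingCat.of k)) :=
    (Spec.map_comp _ _).trans (h.trans (Spec.map_id _).symm)
  exact congrArg CommRingCat.Hom.hom (Spec.map_injective h')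

theorem ker_evalAt_isMaximal (x : KPoint (affine k B)) : (RingHom.ker (evalAt k x)).IsMaximal :=
  RingHom.ker_isMaximal_of_surjective _ fun r =>
    ⟨algebraMap k B r, RingHom.congr_fun (evalAt_comp_algebraMap x) r⟩

/-- The prime ideal of functions that vanish at a `k`-point. -/
def KPoint.prime (x : KPoint (affine k B)) : PrimeSpectrum B :=
  ⟨RingHom.ker (evalAt k x), RingHom.ker_isPrime _⟩

theorem KPoint.pt_eq_prime (x : KPoint (affine k B)) :
    affineChart k B x.pt = x.prime := by
  change x.left (IsLocalRing.closedPoint k) = x.prime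
  rw [KPoint.left_eq]
  refine PrimeSpectrum.ext ?_
  change (IsLocalRing.maximalIdeal k).comap (evalAt k x) = RingHom.ker (evalAt k x)
  rw [IsLocalRing.eq_maximalIdeal (Ideal.bot_isMaximal (K := k)) |>.symm, RingHom.ker]

variable (φ : A →ₐ[k] B) {S : Over (Spec (CommRingCat.of k))}
  (j : S.left ⟶ Spec (CommRingCat.of A)) (f : affine k B ⟶ S)

theorem map_pt_eq_comap
    (hf : f.left ≫ j = Spec.map (CommRingCat.ofHom φ.toRingHom))
    (x : KPoint (affine k B)) :
    j (f.left x.pt) = PrimeSpectrum.comap φ.toRingHom x.prime := by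
  have h1 : j (f.left x.pt) = (f.left ≫ j) x.pt := rfl
  rw [h1, hf, ← KPoint.pt_eq_prime]
  rfl

theorem comap_prime_isMaximal (x : KPoint (affine k B)) :
    (PrimeSpectrum.comap φ.toRingHom x.prime).asIdeal.IsMaximal := by
  have : (PrimeSpectrum.comap φ.toRingHom x.prime).asIdeal =
      RingHom.ker ((evalAt k x).comp φ.toRingHom) := rfl
  rw [this]
  refine RingHom.ker_isMaximal_of_surjective _ fun r => ⟨algebraMap k A r, ?_⟩
  refine (congrArg (evalAt k x) (φ.commutes r)).trans ?_
  exact RingHom.congr_fun (evalAt_comp_algebraMap x) r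

theorem isWeierstrass_of_lifts [IsOpenImmersion j]
    (hf : f.left ≫ j = Spec.map (CommRingCat.ofHom φ.toRingHom))
    (hps : IsProSmooth f.left)
    (H : ∀ x : KPoint (affine k B), LiftsNilpotentAt φ.toRingHom (RingHom.ker (evalAt k x))) :
    IsWeierstrass f := by
  refine ⟨hps, fun x => ?_⟩
  have := comap_prime_isMaximal φ x
  have : x.prime.asIdeal.IsMaximal := ker_evalAt_isMaximal x
  exact isTopFormallySmooth_completedStalkMap f.left j (affineChart k B)
    (CommRingCat.ofHom φ.toRingHom) (hf.trans (Category.id_comp _).symm) x.pt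
    (PrimeSpectrum.comap φ.toRingHom x.prime) x.prime x.pt_eq_prime (map_pt_eq_comap φ j f hf x)
    rfl (H x)

theorem isStrictlyWeierstrassAt_of_lifts [IsOpenImmersion j]
    (hf : f.left ≫ j = Spec.map (CommRingCat.ofHom φ.toRingHom))
    (hps : IsProSmooth f.left) (x : KPoint (affine k B))
    (H : LiftsNilpotentAt φ.toRingHom (RingHom.ker (evalAt k x)))
    (hgen : RingHom.ker (evalAt k x) ≤
      ((RingHom.ker (evalAt k x)).comap φ.toRingHom).map φ.toRingHom) :
    IsStrictlyWeierstrassAt f x := by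
  refine ⟨hps, ?_⟩
  have := comap_prime_isMaximal φ x
  have : x.prime.asIdeal.IsMaximal := ker_evalAt_isMaximal x
  refine isHomeomorph_completedStalkMap_of_lifts f.left j (affineChart k B)
    (CommRingCat.ofHom φ.toRingHom) (hf.trans (Category.id_comp _).symm) x.pt
    (PrimeSpectrum.comap φ.toRingHom x.prime) x.prime x.pt_eq_prime (map_pt_eq_comap φ j f hf x)
    -- The point is `k`-rational, so constants realize every residue.
    rfl H (fun b => ⟨algebraMap k A (evalAt k x b), ?_⟩) hgen
  change evalAt k x (b - φ (algebraMap k A (evalAt k x b))) = 0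
  rw [map_sub, φ.commutes, ← RingHom.comp_apply, evalAt_comp_algebraMap, RingHom.id_apply, sub_self]

/-- The maximal ideal of a `k`-point is generated by the functions on the target that vanish at the
image, when evaluation at the point is determined modulo these functions. -/
theorem ker_le_map_comap (e : B →+* k)
    (he : ∀ (C : Type u) [CommRing C] (c : B →+* C),
      (c.comp φ.toRingHom = (c.comp (algebraMap k B)).comp (e.comp φ.toRingHom)) →
        c = (c.comp (algebraMap k B)).comp e) (hk : e.comp (algebraMap k B) = RingHom.id k) :
    RingHom.ker e ≤ ((RingHom.ker e).comap φ.toRingHom).map φ.toRingHom := by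
  set M := ((RingHom.ker e).comap φ.toRingHom).map φ.toRingHom with hM
  -- `B ⧸ M` is the coordinate ring of the fibre. On it the functions from `A` are constant, so by
  -- `he` every function is constant and those vanishing at the point are 0.
  have h := he (B ⧸ M) (Ideal.Quotient.mk M) <| RingHom.ext fun a => by
    change Ideal.Quotient.mk M (φ a) = Ideal.Quotient.mk M (algebraMap k B (e (φ a)))
    rw [Ideal.Quotient.eq, ← φ.commutes, ← map_sub]
    refine Ideal.mem_map_of_mem φ.toRingHom ?_
    change e (φ (a - algebraMap k A (e (φ a)))) = 0
    rw [map_sub, φ.commutes, map_sub, ← RingHom.comp_apply, hk, RingHom.id_apply, sub_self]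
  intro b hb
  rw [← Ideal.Quotient.eq_zero_iff_mem, h, RingHom.comp_apply, RingHom.mem_ker.mp hb, map_zero]

/-- It is enough to lift the tautological point with values in the residue field at `s`; the kernel
of the lift is a preimage of `s`. -/
theorem surjective_of_exists_hom [IsOpenImmersion j]
    (hf : f.left ≫ j = Spec.map (CommRingCat.ofHom φ.toRingHom))
    (H : ∀ (K : Type u) [Field K] (a : A →+* K) (s : S.left),
      j s = PrimeSpectrum.comap a ⊥ → ∃ c : B →+* K, c.comp φ.toRingHom = a) :
    AlgebraicGeometry.Surjective f.left := by
  refine ⟨fun s => ?_⟩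
  let p : PrimeSpectrum A := j s
  have hp : PrimeSpectrum.comap (algebraMap A p.asIdeal.ResidueField) ⊥ = p := by
    refine PrimeSpectrum.ext ?_
    exact Ideal.ker_algebraMap_residueField p.asIdeal
  obtain ⟨c, hc⟩ := H p.asIdeal.ResidueField (algebraMap A p.asIdeal.ResidueField) s hp.symm
  refine ⟨(PrimeSpectrum.comap c ⊥ : PrimeSpectrum B), j.isOpenEmbedding.injective ?_⟩
  refine (congrArg (fun g : (affine k B).left ⟶ Spec (CommRingCat.of A) =>
    g (show (affine k B).left from PrimeSpectrum.comap c ⊥)) hf).trans ?_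
  change PrimeSpectrum.comap φ.toRingHom (PrimeSpectrum.comap c ⊥) = p
  rw [← PrimeSpectrum.comap_comp_apply, hc, hp]

end Points

end

section

/-! ### The morphism `α_d` -/

theorem ofFin_zero {R : Type*} [CommRing R] {d : ℕ} : ofFin (0 : Fin d → R) = 0 := by
  ext m
  simp [coeff_ofFin]

/-- For `e < d` use `X ^ d + X ^ e = X ^ e * (X ^ (d - e) + 1)`, and for `e = d` use `X ^ d`. -/
theorem exists_monic_eq_X_pow_mul_isUnit {R : Type*} [CommRing R] {d e : ℕ} (he : e ≤ d) :
    ∃ (a : Fin d → R) (p : R⟦X⟧), IsUnit p ∧ PowerSeries.X ^ d + ofFin a = PowerSeries.X ^ e * p := by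
  rcases he.eq_or_lt with rfl | he
  · exact ⟨0, 1, isUnit_one, by rw [ofFin_zero, add_zero, mul_one]⟩
  · refine ⟨fun i => PowerSeries.coeff i (PowerSeries.X ^ e : R⟦X⟧),
      PowerSeries.X ^ (d - e) + 1, ?_, ?_⟩
    · rw [PowerSeries.isUnit_iff_constantCoeff, map_add, map_pow, PowerSeries.constantCoeff_X,
        zero_pow (by omega), zero_add, map_one]
      exact isUnit_one
    · rw [ofFin_coeff, mul_add, ← pow_add, mul_one, Nat.add_sub_cancel' he.le]
      intro m hm
      rw [PowerSeries.coeff_X_pow, if_neg (by omega)]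

/-- Since `u` is invertible, `X ^ d` divides `ofFin a`, which has only terms of degree less than
`d`. This is uniqueness of the factorization near `q = t^d`. -/
theorem eq_of_monic_mul_eq_X_pow_mul {R : Type*} [CommRing R] {d : ℕ} {a : Fin d → R} {u v : R⟦X⟧}
    (hu : IsUnit u) (h : (PowerSeries.X ^ d + ofFin a) * u = PowerSeries.X ^ d * v) :
    a = 0 ∧ u = v := by
  obtain ⟨w, hw⟩ := hu.exists_right_inv
  have h1 : ofFin a = PowerSeries.X ^ d * ((v - u) * w) := by
    linear_combination w * h - ofFin a * hw
  have ha : a = 0 := by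
    funext i
    rw [← coeff_ofFin_of_lt a i.2, h1, PowerSeries.coeff_X_pow_mul', if_neg (by omega)]
    rfl
  refine ⟨ha, ?_⟩
  rw [ha, ofFin_zero, add_zero] at h
  ext n
  have := congrArg (PowerSeries.coeff (n + d)) h
  rwa [PowerSeries.coeff_X_pow_mul, PowerSeries.coeff_X_pow_mul] at this

theorem isUnit_iff_coeff_zero {R : Type*} [CommRing R] {f : R⟦X⟧} :
    IsUnit f ↔ IsUnit (PowerSeries.coeff 0 f) := by
  rw [PowerSeries.isUnit_iff_constantCoeff, PowerSeries.coeff_zero_eq_constantCoeff_apply]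

/-- The equations `w u_0 = 1` and `y = (X ^ d + a) u` for truncated power series. -/
def unitFactorEqs {P : Type*} [CommRing P] {d N : ℕ} (hN : 0 < N) (a : Fin d → P) (w : P)
    (u y : Fin N → P) : Unit ⊕ Fin N → P :=
  Sum.elim (fun _ => w * u ⟨0, hN⟩ - 1)
    (fun i => PowerSeries.coeff i ((PowerSeries.X ^ d + ofFin a) * ofFin u) - y i)

theorem map_unitFactorEqs {P P' : Type*} [CommRing P] [CommRing P'] (g : P →+* P') {d N : ℕ}
    (hN : 0 < N) (a : Fin d → P) (w : P) (u y : Fin N → P) (t : Unit ⊕ Fin N) :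
    g (unitFactorEqs hN a w u y t) = unitFactorEqs hN (g ∘ a) (g w) (g ∘ u) (g ∘ y) t := by
  rcases t with t | i
  · simp [unitFactorEqs]
  · simp only [unitFactorEqs, Sum.elim_inr, map_sub, Function.comp_apply]
    rw [← PowerSeries.coeff_map, map_mul, map_X_pow_add_ofFin, map_ofFin]

theorem unitFactorEqs_restrict {P : Type*} [CommRing P] {d N M : ℕ} (hNM : N ≤ M)
    (hN : 0 < N) (hM : 0 < M) (a : Fin d → P) (w : P) (u y : Fin M → P) (t : Unit ⊕ Fin N) :
    unitFactorEqs hN a w (u ∘ Fin.castLE hNM) (y ∘ Fin.castLE hNM) t =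
      unitFactorEqs hM a w u y (Sum.map id (Fin.castLE hNM) t) := by
  rcases t with t | i
  · rfl
  · simp only [unitFactorEqs, Sum.elim_inr, Sum.map_inr, Function.comp_apply, Fin.val_castLE]
    congr 1
    refine coeff_mul_congr _ (N := N) (fun m hm => ?_) i.2
    rw [coeff_ofFin_of_lt _ hm, coeff_ofFin_of_lt _ (hm.trans_le hNM)]
    rfl

/-- A single Newton step for the truncated equations. With residual `r`, solve `v + q ξ = u⁻¹ r` to
order `N` by Euclidean division and correct `q` by `v` and `u` by `u ξ`. The cross term vanishes as
`J ^ 2 = 0`. Unlike in `exists_factorization`, no condition on `q` beyond monicity is needed. -/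
theorem unitFactorEqs_lift {C : Type*} [CommRing C] {J : Ideal C} (hJ : J ^ 2 = ⊥) {d N : ℕ}
    (hN : 0 < N) (a : Fin d → C) (w : C) (u y : Fin N → C)
    (h : ∀ t, unitFactorEqs hN a w u y t ∈ J) :
    ∃ (a' : Fin d → C) (w' : C) (u' : Fin N → C), (∀ i, a' i - a i ∈ J) ∧ w' - w ∈ J ∧
      (∀ i, u' i - u i ∈ J) ∧ ∀ t, unitFactorEqs hN a' w' u' y t = 0 := by
  have hJn : IsNilpotent J := ⟨2, hJ⟩
  have hJ2 : ∀ x ∈ J, ∀ z ∈ J, x * z = 0 := fun x hx z hz => by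
    have := Ideal.mul_mem_mul hx hz
    rwa [← sq, hJ] at this
  have hlift : ∀ z z' : C, IsUnit z → z' - z ∈ J → IsUnit z' := fun z z' hz hzz' => by
    have h0 : IsNilpotent (z' - z) := ⟨2, by rw [sq]; exact hJ2 _ hzz' _ hzz'⟩
    have := h0.isUnit_add_left_of_commute hz (Commute.all _ _)
    rwa [add_sub_cancel] at this
  have h0 : w * u ⟨0, hN⟩ - 1 ∈ J := h (Sum.inl ())
  have hu0 : IsUnit (u ⟨0, hN⟩) :=
    isUnit_of_mul_isUnit_right (hlift 1 (w * u ⟨0, hN⟩) isUnit_one h0)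
  have hU : IsUnit (ofFin u) := isUnit_iff_coeff_zero.mpr (by rwa [coeff_ofFin_of_lt _ hN])
  obtain ⟨z, hz⟩ := hU.exists_right_inv
  let r : Fin N → C := fun i =>
    y i - PowerSeries.coeff i ((PowerSeries.X ^ d + ofFin a) * ofFin u)
  have hr : ∀ i, r i ∈ J := fun i => by
    rw [← neg_mem_iff, neg_sub]
    exact h (Sum.inr i)
  obtain ⟨v, ξ, hv, hξ, hdiv⟩ := exists_division_of_monic a N J (z * ofFin r)
    (coeff_mul_mem_right _ (coeff_ofFin_mem hr))
  -- Truncating `u ξ` below order `N` does not affect the equations, which only see the first `N`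
  -- coefficients of products.
  let μ : Fin N → C := fun i => PowerSeries.coeff i (ofFin u * ξ)
  have hμ : ∀ i, μ i ∈ J := fun i => coeff_mul_mem_right _ hξ i
  have hu0' : IsUnit ((u + μ) ⟨0, hN⟩) := hlift _ _ hu0 (by simpa using hμ ⟨0, hN⟩)
  obtain ⟨w', hw'⟩ := hu0'.exists_left_inv
  refine ⟨a + v, w', u + μ, fun i => by simpa using hv i, ?_, fun i => by simpa using hμ i, ?_⟩
  · have : w' - w = w' * (1 - w * u ⟨0, hN⟩) - w * w' * μ ⟨0, hN⟩ := by
      have h3 : w' * (u ⟨0, hN⟩ + μ ⟨0, hN⟩) = 1 := hw'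
      linear_combination w * h3
    rw [this]
    refine sub_mem (Ideal.mul_mem_left _ _ ?_) (Ideal.mul_mem_left _ _ (hμ _))
    rw [← neg_mem_iff, neg_sub]
    exact h0
  · rintro (t | i)
    · exact sub_eq_zero.mpr hw'
    · change PowerSeries.coeff i ((PowerSeries.X ^ d + ofFin (a + v)) * ofFin (u + μ)) - y i = 0
      have h1 : (PowerSeries.X ^ d + ofFin (a + v)) * ofFin (u + μ) =
          (PowerSeries.X ^ d + ofFin a) * ofFin u +
            ((PowerSeries.X ^ d + ofFin a) * ofFin μ + ofFin v * ofFin u) + ofFin v * ofFin μ := by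
        rw [ofFin_add, ofFin_add]
        ring
      have h2 : PowerSeries.coeff i (ofFin v * ofFin μ) = 0 := by
        have := coeff_mul_mem (coeff_ofFin_mem hv) (coeff_ofFin_mem hμ) i
        rwa [← sq, hJ] at this
      have h3 : PowerSeries.coeff i ((PowerSeries.X ^ d + ofFin a) * ofFin μ) =
          PowerSeries.coeff i ((PowerSeries.X ^ d + ofFin a) * (ofFin u * ξ)) :=
        coeff_mul_congr _ (fun m hm => by rw [coeff_ofFin_of_lt _ hm]) i.2
      have h4 : PowerSeries.coeff i (ofFin u * (z * ofFin r)) = r i := by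
        rw [← mul_assoc, hz, one_mul, coeff_ofFin_of_lt _ i.2]
      have h5 : PowerSeries.coeff i (ofFin u * (ofFin v + (PowerSeries.X ^ d + ofFin a) * ξ)) =
          r i := by
        rw [← h4]
        exact coeff_mul_congr _ hdiv i.2
      have h6 : ofFin u * (ofFin v + (PowerSeries.X ^ d + ofFin a) * ξ) =
          (PowerSeries.X ^ d + ofFin a) * (ofFin u * ξ) + ofFin v * ofFin u := by ring
      rw [h1, map_add, map_add, map_add, h2, h3, ← map_add, ← h6, h5]
      simp [r]

/-- The coefficient 1 of `X ^ d` in `q = (q u) u⁻¹` is a combination of the coefficients of `q u` in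
degrees at most `d`, which are `y_0, …, y_d` because `d < N`. They cannot all lie in a proper ideal.
-/
theorem exists_notMem_of_unitFactorEqs {C : Type*} [CommRing C] {d N : ℕ} (hd : d < N)
    (hN : 0 < N) (a : Fin d → C) (w : C) (u y : Fin N → C)
    (h : ∀ t, unitFactorEqs hN a w u y t = 0) {I : Ideal C} (hI : I ≠ ⊤) :
    ∃ i : Fin N, (i : ℕ) ≤ d ∧ y i ∉ I := by
  by_contra! hy
  have h0 : w * u ⟨0, hN⟩ = 1 := sub_eq_zero.mp (h (Sum.inl ()))
  have hU : IsUnit (ofFin u) := isUnit_iff_coeff_zero.mpr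
    (by rw [coeff_ofFin_of_lt _ hN]; exact IsUnit.of_mul_eq_one_right w h0)
  obtain ⟨z, hz⟩ := hU.exists_right_inv
  refine hI ((Ideal.eq_top_iff_one I).mpr ?_)
  rw [← coeff_X_pow_add_ofFin a, ← mul_one (PowerSeries.X ^ d + ofFin a), ← hz, ← mul_assoc,
    PowerSeries.coeff_mul]
  refine Ideal.sum_mem _ fun ij hij => Ideal.mul_mem_right _ _ ?_
  have hle : ij.1 ≤ d := by
    have := Finset.HasAntidiagonal.mem_antidiagonal.mp hij
    omega
  have := sub_eq_zero.mp (h (Sum.inr ⟨ij.1, hle.trans_lt hd⟩))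
  rw [this]
  exact hy _ hle

variable (k : Type u) [Field k] (d : ℕ)

/-- The open immersion of the arcs of valuation at most `d` into all arcs. -/
def arcsLEChart : (arcsLE k d).left ⟶ Spec (CommRingCat.of (LA1Ring k)) := (arcsLEOpen k d).ι

instance : IsOpenImmersion (arcsLEChart k d) := inferInstanceAs (IsOpenImmersion (arcsLEOpen k d).ι)

theorem alpha_comp_arcsLEChart : (alpha k d).left ≫ arcsLEChart k d =
    Spec.map (CommRingCat.ofHom (alphaComorphism k d).toRingHom) :=
  alphaScheme_comp k d

theorem mem_arcsLEOpen_iff (p : PrimeSpectrum (LA1Ring k)) :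
    (show (affine k (LA1Ring k)).left from p) ∈ arcsLEOpen k d ↔
      ∃ i ≤ d, (MvPolynomial.X i : LA1Ring k) ∉ p.asIdeal := by
  have h1 : (show (affine k (LA1Ring k)).left from p) ∈ arcsLEOpen k d ↔
      ¬ ∀ i : Fin (d + 1), MvPolynomial.rename (fun i : Fin (d + 1) => (i : ℕ))
        (MvPolynomial.X i : MvPolynomial (Fin (d + 1)) k) ∈ p.asIdeal := by
    refine not_congr ⟨fun h i => h ⟨i, rfl⟩, ?_⟩
    rintro h _ ⟨i, rfl⟩
    exact h i
  rw [h1, not_forall]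
  simp only [MvPolynomial.rename_X]
  constructor
  · rintro ⟨i, hi⟩
    exact ⟨i, Nat.lt_succ_iff.mp i.2, hi⟩
  · rintro ⟨i, hi, h⟩
    exact ⟨⟨i, Nat.lt_succ_iff.mpr hi⟩, h⟩

theorem mem_range_arcsLEChart_iff (p : PrimeSpectrum (LA1Ring k)) :
    p ∈ Set.range (arcsLEChart k d) ↔ ∃ i ≤ d, (MvPolynomial.X i : LA1Ring k) ∉ p.asIdeal := by
  rw [← mem_arcsLEOpen_iff]
  exact Set.ext_iff.mp (Scheme.Opens.range_ι (arcsLEOpen k d)) p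

theorem surjective_alpha : AlgebraicGeometry.Surjective (alpha k d).left := by
  refine surjective_of_exists_hom (alphaComorphism k d) (arcsLEChart k d)
    (alpha k d) (alpha_comp_arcsLEChart k d) fun K _ a s hs => ?_
  obtain ⟨i, hi, hai⟩ := (mem_range_arcsLEChart_iff k d _).mp ⟨s, hs⟩
  obtain ⟨e, he, w, hw, hfac⟩ := exists_X_pow_mul_isUnit (PowerSeries.map a (univArc k)) d
    ⟨i, hi, fun h => hai <| by simpa [univArc] using h⟩
  obtain ⟨q, p, hp, hq⟩ := exists_monic_eq_X_pow_mul_isUnit (R := K) he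
  obtain ⟨p', hpp'⟩ := hp.exists_right_inv
  obtain ⟨c, hck, hca, hcu⟩ := AlphaRing.exists_hom (k := k) (d := d)
    (a.comp (algebraMap k _)) q (p' * w)
    ((IsUnit.of_mul_eq_one_right p hpp').mul hw)
  refine ⟨c, LA1Ring.hom_ext ?_ ?_⟩
  · rw [RingHom.comp_assoc]
    exact (congrArg c.comp (alphaComorphism k d).comp_algebraMap).trans hck
  · rw [map_alphaComorphism, hcu, hfac, show c ∘ alphaCoeff k d = q from funext hca, hq]
    linear_combination (PowerSeries.X ^ e * w) * hpp'

theorem ker_le_map_comap_alpha (e : AlphaRing k d →+* k)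
    (he : e.comp (algebraMap k _) = RingHom.id k) (h : ∀ i, e (alphaCoeff k d i) = 0) :
    RingHom.ker e ≤ ((RingHom.ker e).comap (alphaComorphism k d).toRingHom).map
      (alphaComorphism k d).toRingHom := by
  refine ker_le_map_comap (alphaComorphism k d) e (fun C _ c hc => ?_) he
  have h1 := congrArg (fun g => PowerSeries.map g (univArc k)) hc
  simp only [← RingHom.comp_assoc] at h1
  rw [map_alphaComorphism, map_alphaComorphism] at h1
  have h2 : ((c.comp (algebraMap k _)).comp e) ∘ alphaCoeff k d = 0 := funext fun i => by
    rw [Function.comp_apply, RingHom.comp_apply, h, map_zero]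
    rfl
  rw [h2, ofFin_zero, add_zero] at h1
  obtain ⟨h3, h4⟩ := eq_of_monic_mul_eq_X_pow_mul ((isUnit_alphaUnit k d).map _) h1
  refine AlphaRing.hom_ext ?_ (fun i => ?_) h4
  · rw [RingHom.comp_assoc, he, RingHom.comp_id]
  · exact (congrFun h3 i).trans (congrFun h2 i).symm

theorem alphaComorphism_X (n : ℕ) : alphaComorphism k d (MvPolynomial.X n) =
    PowerSeries.coeff n ((PowerSeries.X ^ d + ofFin (alphaCoeff k d)) * alphaUnit k d) := by
  rw [alphaComorphism, classify, MvPolynomial.aeval_X, coe_alphaPoly]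

/-- The unknowns are the coefficients of `q`, an inverse `w` of `u_0`, which makes invertibility of
`u` an equation, and the coefficients of `u` below `N = d + 1 + n`. Starting at `N = d + 1` ensures
that all stages map to the arcs of valuation at most `d`. -/
theorem isProSmooth_alpha : IsProSmooth (alpha k d).left := by
  let R (n : ℕ) : Unit ⊕ Fin (d + 1 + n) →
      MvPolynomial ((Fin d ⊕ Unit) ⊕ Fin (d + 1 + n)) (LA1Ring k) :=
    unitFactorEqs (by omega) (fun i => MvPolynomial.X (Sum.inl (Sum.inl i)))
      (MvPolynomial.X (Sum.inl (Sum.inr ()))) (fun i => MvPolynomial.X (Sum.inr i))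
      (fun i => MvPolynomial.C (MvPolynomial.X i))
  have hR (n : ℕ) {C : Type u} [CommRing C] (a : LA1Ring k →+* C)
      (x : (Fin d ⊕ Unit) ⊕ Fin (d + 1 + n) → C) (t) : MvPolynomial.eval₂Hom a x (R n t) =
      unitFactorEqs (by omega) (fun i => x (Sum.inl (Sum.inl i))) (x (Sum.inl (Sum.inr ())))
        (fun i => x (Sum.inr i)) (fun i => a (MvPolynomial.X i)) t := by
    refine (map_unitFactorEqs _ _ _ _ _ _ _).trans ?_
    congr 1 <;> simp [Function.comp_def]
  obtain ⟨w, hw⟩ : ∃ w, w * PowerSeries.coeff 0 (alphaUnit k d) = 1 :=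
    IsUnit.exists_left_inv (isUnit_iff_coeff_zero.mp (isUnit_alphaUnit k d))
  have htrunc {C : Type u} [CommRing C] (f : C⟦X⟧) (N : ℕ) (q : C⟦X⟧) (i : ℕ) (hi : i < N) :
      PowerSeries.coeff i (q * ofFin fun j : Fin N => PowerSeries.coeff j f) =
        PowerSeries.coeff i (q * f) :=
    coeff_mul_congr q (fun m hm => by rw [coeff_ofFin_of_lt _ hm]) hi
  refine isProSmooth_of_presentation (CommRingCat.ofHom (alphaComorphism k d).toRingHom)
    (arcsLEChart k d) (alpha k d).left (alpha_comp_arcsLEChart k d) (d + 1) R (fun n t => ?_)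
    (fun n C _ a J hJ x hx => ?_) (fun n C _ a x hx => ?_)
    (Sum.elim (Sum.elim (alphaCoeff k d) fun _ => w) fun n => PowerSeries.coeff n (alphaUnit k d))
    (fun n t => ?_) (fun C _ a x hx => ?_) (fun C _ h h' hφ hb => ?_)
  · have h1 := map_unitFactorEqs (MvPolynomial.rename (R := LA1Ring k)
      (Sum.map (id : Fin d ⊕ Unit → _) (Fin.castSucc (n := d + 1 + n)))).toRingHom
      (N := d + 1 + n) (by omega) (fun i => MvPolynomial.X (Sum.inl (Sum.inl i)))
      (MvPolynomial.X (Sum.inl (Sum.inr ()))) (fun i => MvPolynomial.X (Sum.inr i))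
      (fun i => MvPolynomial.C (MvPolynomial.X i)) t
    refine h1.trans (Eq.trans ?_ (unitFactorEqs_restrict (Nat.le_succ (d + 1 + n)) (by omega) _ _ _ _ _ t))
    congr 1 <;> simp [Function.comp_def]
    rfl
  · obtain ⟨a', w', u', ha, hw, hu, h⟩ := unitFactorEqs_lift hJ _ _ _ _ _ fun t => hR n a x t ▸ hx t
    refine ⟨Sum.elim (Sum.elim a' fun _ => w') u', ?_, fun t => (hR n a _ t).trans (h t)⟩
    rintro ((i | i) | i)
    exacts [ha i, hw, hu i]
  · rintro _ ⟨p, rfl⟩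
    obtain ⟨i, hi, hmem⟩ := exists_notMem_of_unitFactorEqs (by omega) _ _ _ _ _
      (fun t => (hR n a x t).symm.trans (hx t)) p.2.ne_top
    exact (mem_range_arcsLEChart_iff k d _).mpr ⟨i, hi, hmem⟩
  · refine (hR n _ _ t).trans ?_
    rcases t with t | i
    · exact sub_eq_zero.mpr hw
    · refine sub_eq_zero.mpr ((htrunc (alphaUnit k d) _ _ i i.2).trans ?_)
      exact (alphaComorphism_X k d i).symm
  · have hx' (n t) := (hR n a _ t).symm.trans (hx n t)
    have h0 : x (Sum.inl (Sum.inr ())) * x (Sum.inr 0) = 1 := sub_eq_zero.mp (hx' 0 (Sum.inl ()))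
    obtain ⟨c, hck, hca, hcu⟩ := AlphaRing.exists_hom (k := k) (d := d)
      (a.comp (algebraMap k _)) (fun i => x (Sum.inl (Sum.inl i)))
      (PowerSeries.mk fun n => x (Sum.inr n))
      (isUnit_iff_coeff_zero.mpr (by
        rw [PowerSeries.coeff_mk]
        exact IsUnit.of_mul_eq_one_right _ h0))
    have hcu' (n : ℕ) : c (PowerSeries.coeff n (alphaUnit k d)) = x (Sum.inr n) := by
      rw [← PowerSeries.coeff_map, hcu, PowerSeries.coeff_mk]
    refine ⟨c, LA1Ring.hom_ext ?_ ?_, ?_⟩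
    · rw [RingHom.comp_assoc]
      exact (congrArg c.comp (alphaComorphism k d).comp_algebraMap).trans hck
    · refine (map_alphaComorphism c).trans ?_
      rw [hcu, show c ∘ alphaCoeff k d = _ from funext hca]
      ext n
      have h1 := sub_eq_zero.mp (hx' n (Sum.inr ⟨n, by omega⟩))
      have h2 := htrunc (PowerSeries.mk fun n => x (Sum.inr n)) (d + 1 + n)
        (PowerSeries.X ^ d + ofFin fun i => x (Sum.inl (Sum.inl i))) n (by omega)
      simp only [PowerSeries.coeff_mk] at h2
      rw [← h2, PowerSeries.coeff_map, univArc, PowerSeries.coeff_mk]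
      exact h1
    · rintro ((i | i) | n)
      · exact hca i
      -- Both elements are inverses of the image of `u_0`.
      · have h1 := congrArg c hw
        rw [map_mul, map_one, hcu'] at h1
        change c w = x (Sum.inl (Sum.inr ()))
        linear_combination x (Sum.inl (Sum.inr ())) * h1 - c w * h0
      · exact hcu' n
  · refine AlphaRing.hom_ext ?_ (fun i => hb (Sum.inl (Sum.inl i))) ?_
    · have h1 := congrArg (fun g => g.comp (algebraMap k (LA1Ring k))) hφ
      simp only [RingHom.comp_assoc] at h1
      rwa [show (CommRingCat.ofHom (alphaComorphism k d).toRingHom).hom.comp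
        (algebraMap k (LA1Ring k)) = algebraMap k _ from (alphaComorphism k d).comp_algebraMap] at h1
    · ext n
      exact hb (Sum.inr n)

end

/-! ### Division by a monic polynomial -/

theorem eq_of_ofFin_add_X_pow_mul_eq {R : Type*} [CommRing R] {d : ℕ} {v v' : Fin d → R} {ξ ξ' : R⟦X⟧}
    (h : ofFin v + PowerSeries.X ^ d * ξ = ofFin v' + PowerSeries.X ^ d * ξ') :
    v = v' ∧ ξ = ξ' := by
  have hv : v = v' := by
    funext i
    have := congrArg (PowerSeries.coeff i) h
    rwa [map_add, map_add, coeff_ofFin_of_lt _ i.2, coeff_ofFin_of_lt _ i.2,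
      PowerSeries.coeff_X_pow_mul', if_neg (by omega), PowerSeries.coeff_X_pow_mul',
      if_neg (by omega), add_zero, add_zero] at this
  subst hv
  refine ⟨rfl, ?_⟩
  ext n
  have := congrArg (PowerSeries.coeff (n + d)) (add_left_cancel h)
  rwa [PowerSeries.coeff_X_pow_mul, PowerSeries.coeff_X_pow_mul] at this

/-- The equations `y = v + (X ^ d + a) ξ` for truncated power series. -/
def divisionEqs {P : Type*} [CommRing P] {d N : ℕ} (a v : Fin d → P) (ξ y : Fin N → P) :
    Empty ⊕ Fin N → P :=
  Sum.elim Empty.elim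
    (fun i => PowerSeries.coeff i (ofFin v + (PowerSeries.X ^ d + ofFin a) * ofFin ξ) - y i)

theorem map_divisionEqs {P P' : Type*} [CommRing P] [CommRing P'] (g : P →+* P') {d N : ℕ}
    (a v : Fin d → P) (ξ y : Fin N → P) (t : Empty ⊕ Fin N) :
    g (divisionEqs a v ξ y t) = divisionEqs (g ∘ a) (g ∘ v) (g ∘ ξ) (g ∘ y) t := by
  rcases t with t | i
  · exact t.elim
  · simp only [divisionEqs, Sum.elim_inr, map_sub, Function.comp_apply]
    rw [← PowerSeries.coeff_map, map_add, map_mul, map_X_pow_add_ofFin, map_ofFin, map_ofFin]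

theorem coeff_add_mul_ofFin_coeff {P : Type*} [CommRing P] (r q f : P⟦X⟧) {N i : ℕ} (hi : i < N) :
    PowerSeries.coeff i (r + q * ofFin fun j : Fin N => PowerSeries.coeff j f) =
      PowerSeries.coeff i (r + q * f) := by
  rw [map_add, map_add]
  exact congrArg _ (coeff_mul_congr q (fun m hm => by rw [coeff_ofFin_of_lt _ hm]) hi)

theorem divisionEqs_restrict {P : Type*} [CommRing P] {d N M : ℕ} (hNM : N ≤ M)
    (a v : Fin d → P) (ξ y : Fin M → P) (t : Empty ⊕ Fin N) :
    divisionEqs a v (ξ ∘ Fin.castLE hNM) (y ∘ Fin.castLE hNM) t =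
      divisionEqs a v ξ y (Sum.map id (Fin.castLE hNM) t) := by
  rcases t with t | i
  · exact t.elim
  · simp only [divisionEqs, Sum.elim_inr, Sum.map_inr, Function.comp_apply, Fin.val_castLE,
      map_add (PowerSeries.coeff (i : ℕ))]
    congr 2
    refine coeff_mul_congr _ (N := N) (fun m hm => ?_) i.2
    rw [coeff_ofFin_of_lt _ hm, coeff_ofFin_of_lt _ (hm.trans_le hNM)]
    rfl

/-- For fixed `q` the equations are affine in `(v, ξ)`. Dividing the residual by `q` and subtracting
therefore gives an exact solution, with no condition on `J`. -/
theorem divisionEqs_lift {C : Type*} [CommRing C] (J : Ideal C) {d N : ℕ} (a v : Fin d → C)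
    (ξ y : Fin N → C) (h : ∀ t, divisionEqs a v ξ y t ∈ J) :
    ∃ (v' : Fin d → C) (ξ' : Fin N → C), (∀ i, v' i - v i ∈ J) ∧ (∀ i, ξ' i - ξ i ∈ J) ∧
      ∀ t, divisionEqs a v' ξ' y t = 0 := by
  let r : Fin N → C := fun i => divisionEqs a v ξ y (Sum.inr i)
  obtain ⟨v', ξ', hv, hξ, hdiv⟩ := exists_division_of_monic a N J (ofFin r)
    (coeff_ofFin_mem fun i => h (Sum.inr i))
  refine ⟨v - v', ξ - fun i : Fin N => PowerSeries.coeff i ξ', fun i => by simpa using hv i,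
    fun i => by simpa using hξ i, ?_⟩
  rintro (t | i)
  · exact t.elim
  · have h1 := hdiv i i.2
    rw [← coeff_add_mul_ofFin_coeff _ _ _ i.2, coeff_ofFin_of_lt _ i.2] at h1
    change _ = PowerSeries.coeff i (ofFin v + (PowerSeries.X ^ d + ofFin a) * ofFin ξ) - y i at h1
    change PowerSeries.coeff i (ofFin (v - v') + (PowerSeries.X ^ d + ofFin a) * ofFin (ξ - _)) -
      y i = 0
    rw [ofFin_sub, ofFin_sub, mul_sub, sub_add_sub_comm, map_sub, h1]
    ring

/-! ### The morphism `(q, v, ξ) ↦ (q, v + q ξ)` between rings known by universal properties -/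

section Division

variable {k : Type u} [Field k] {d : ℕ}

/-- A universal pair `(q, f)` of a monic polynomial of degree `d` and a power series. -/
structure UniversalPair (k : Type u) [Field k] (d : ℕ) (A : Type u) [CommRing A] [Algebra k A] where
  /-- The coefficients of `q`. -/
  coeff : Fin d → A
  /-- The power series `f`. -/
  arc : A⟦X⟧
  hom_ext : ∀ {C : Type u} [CommRing C] {c c' : A →+* C},
    c.comp (algebraMap k A) = c'.comp (algebraMap k A) → (∀ i, c (coeff i) = c' (coeff i)) →
      PowerSeries.map c arc = PowerSeries.map c' arc → c = c'

/-- A universal triple `(q, v, ξ)` of a monic polynomial of degree `d`, a polynomial of degree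
less than `d` and a power series. -/
structure UniversalTriple (k : Type u) [Field k] (d : ℕ) (B : Type u) [CommRing B]
    [Algebra k B] where
  /-- The coefficients of `q`. -/
  coeff : Fin d → B
  /-- The coefficients of `v`. -/
  rem : Fin d → B
  /-- The power series `ξ`. -/
  arc : B⟦X⟧
  hom_ext : ∀ {C : Type u} [CommRing C] {c c' : B →+* C},
    c.comp (algebraMap k B) = c'.comp (algebraMap k B) → (∀ i, c (coeff i) = c' (coeff i)) →
      (∀ i, c (rem i) = c' (rem i)) → PowerSeries.map c arc = PowerSeries.map c' arc → c = c'
  exists_hom : ∀ {C : Type u} [CommRing C] (s : k →+* C) (a v : Fin d → C) (ξ : C⟦X⟧),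
    ∃ c : B →+* C, c.comp (algebraMap k B) = s ∧ (∀ i, c (coeff i) = a i) ∧
      (∀ i, c (rem i) = v i) ∧ PowerSeries.map c arc = ξ

variable {A B : Type u} [CommRing A] [Algebra k A] [CommRing B] [Algebra k B]

theorem comp_comp_algebraMap (φ : A →ₐ[k] B) {C : Type*} [CommRing C] (c : B →+* C) :
    (c.comp φ.toRingHom).comp (algebraMap k A) = c.comp (algebraMap k B) := by
  rw [RingHom.comp_assoc]
  exact congrArg c.comp φ.comp_algebraMap

theorem affineMap_comp_affineChart (φ : A →ₐ[k] B) : (affineMap k φ).left ≫ affineChart k A =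
    Spec.map (CommRingCat.ofHom φ.toRingHom) :=
  Category.comp_id _

/-- `φ` is the comorphism of `(q, v, ξ) ↦ (q, v + q ξ)`. -/
structure IsDivisionComorphism (φ : A →ₐ[k] B) (P : UniversalPair k d A)
    (T : UniversalTriple k d B) : Prop where
  coeff : ∀ i, φ (P.coeff i) = T.coeff i
  arc : PowerSeries.map φ.toRingHom P.arc =
    ofFin T.rem + (PowerSeries.X ^ d + ofFin T.coeff) * T.arc

namespace IsDivisionComorphism

variable {φ : A →ₐ[k] B} {P : UniversalPair k d A} {T : UniversalTriple k d B}

theorem map_comp_arc (hφ : IsDivisionComorphism φ P T) {C : Type*} [CommRing C] (c : B →+* C) :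
    PowerSeries.map (c.comp φ.toRingHom) P.arc =
      ofFin (c ∘ T.rem) + (PowerSeries.X ^ d + ofFin (c ∘ T.coeff)) *
        PowerSeries.map c T.arc := by
  rw [PowerSeries.map_comp, RingHom.comp_apply, hφ.arc, map_add, map_mul,
    map_ofFin, map_X_pow_add_ofFin]

theorem comp_eq (hφ : IsDivisionComorphism φ P T) {C : Type u} [CommRing C] {c : B →+* C}
    {a : A →+* C} (hk : c.comp (algebraMap k B) = a.comp (algebraMap k A))
    (ha : ∀ i, c (T.coeff i) = a (P.coeff i))
    (hf : ofFin (c ∘ T.rem) + (PowerSeries.X ^ d + ofFin (c ∘ T.coeff)) *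
        PowerSeries.map c T.arc = PowerSeries.map a P.arc) :
    c.comp φ.toRingHom = a := by
  refine P.hom_ext ?_ (fun i => ?_) ?_
  · rw [RingHom.comp_assoc]
    exact (congrArg c.comp φ.comp_algebraMap).trans hk
  · exact (congrArg c (hφ.coeff i)).trans (ha i)
  · rw [hφ.map_comp_arc, hf]

/-- The polynomial `q` comes from the target and is already given over `C`; only `v` and `ξ` have to
be lifted. Arbitrary lifts leave a residual with coefficients in `J`, and `exists_division` absorbs
it by corrections in `J`. -/
theorem liftsNilpotentAt (hφ : IsDivisionComorphism φ P T) (e : B →+* k)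
    (he : e.comp (algebraMap k B) = RingHom.id k) :
    LiftsNilpotentAt φ.toRingHom (RingHom.ker e) := by
  intro C _ J N hJ a b _ hb hab
  let s : k →+* C := a.comp (algebraMap k A)
  have hs : (Ideal.Quotient.mk J).comp s = b.comp (algebraMap k B) := by
    rw [← RingHom.comp_assoc, hab, comp_comp_algebraMap φ]
  obtain ⟨I, hI, -, hmem⟩ := exists_nilpotent_ideal e he hJ b N hb s hs
  obtain ⟨i, hi, w, hw, hq⟩ := exists_X_pow_mul_isUnit
    (PowerSeries.X ^ d + ofFin (e ∘ T.coeff)) d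
    ⟨d, le_rfl, by rw [coeff_X_pow_add_ofFin]; exact one_ne_zero⟩
  let a₀ : Fin d → C := a ∘ P.coeff
  have ha₀ (i) : Ideal.Quotient.mk J (a₀ i) = b (T.coeff i) := by
    rw [← hφ.coeff]
    exact RingHom.congr_fun hab _
  choose v₀ hv₀ using fun i => Ideal.Quotient.mk_surjective (b (T.rem i))
  obtain ⟨ξ₀, hξ₀⟩ := exists_map_mk_eq (PowerSeries.map b T.arc)
  have hq₀ : ∀ n, PowerSeries.coeff n
      (PowerSeries.X ^ d + ofFin a₀ - PowerSeries.X ^ i * PowerSeries.map s w) ∈ I := by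
    have h1 : PowerSeries.X ^ i * PowerSeries.map s w =
        PowerSeries.X ^ d + ofFin (s ∘ e ∘ T.coeff) := by
      rw [← map_X_pow_add_ofFin, hq, map_mul, map_pow, PowerSeries.map_X]
    rw [h1, add_sub_add_left_eq_sub, ← ofFin_sub]
    exact coeff_ofFin_mem fun i => hmem _ _ (ha₀ i)
  obtain ⟨v, ξ, hv, hξ, hdiv⟩ := exists_division hI hi (hw.map (PowerSeries.map s)) hq₀ J
    (PowerSeries.map a P.arc -
      (ofFin v₀ + (PowerSeries.X ^ d + ofFin a₀) * ξ₀)) <| by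
      rw [← map_mk_eq_map_mk_iff, ← RingHom.comp_apply, ← PowerSeries.map_comp, hab,
        hφ.map_comp_arc, map_add, map_mul, map_X_pow_add_ofFin, map_ofFin, hξ₀,
        show b ∘ T.coeff = _ from (funext ha₀).symm,
        show b ∘ T.rem = _ from (funext hv₀).symm]
      rfl
  obtain ⟨c, hck, hca, hcv, hcξ⟩ := T.exists_hom s a₀ (v₀ + v) (ξ₀ + ξ)
  refine ⟨c, hφ.comp_eq hck hca ?_, T.hom_ext ?_ (fun i => ?_) (fun i => ?_) ?_⟩
  · rw [hcξ, show c ∘ T.coeff = _ from funext hca,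
      show c ∘ T.rem = _ from funext hcv, ofFin_add]
    linear_combination hdiv
  · rw [RingHom.comp_assoc, hck, hs]
  · rw [RingHom.comp_apply, hca, ha₀]
  · rw [RingHom.comp_apply, hcv, ← hv₀, Ideal.Quotient.eq]
    simpa using hv i
  · rw [PowerSeries.map_comp, RingHom.comp_apply, hcξ, ← hξ₀, map_mk_eq_map_mk_iff]
    simpa using hξ

/-- Over a field `q` is exactly a power of `X` times a unit, so division by it is possible with zero
error ideal. -/
theorem surjective (hφ : IsDivisionComorphism φ P T) : AlgebraicGeometry.Surjective (affineMap k φ).left := by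
  refine surjective_of_exists_hom φ (affineChart k A)
    (affineMap k φ) (affineMap_comp_affineChart φ) fun K _ a _ _ => ?_
  obtain ⟨e, he, w, hw, hfac⟩ := exists_X_pow_mul_isUnit
    (PowerSeries.X ^ d + ofFin (a ∘ P.coeff)) d
    ⟨d, le_rfl, by rw [coeff_X_pow_add_ofFin]; exact one_ne_zero⟩
  obtain ⟨v, ξ, -, -, hdiv⟩ := exists_division (I := (⊥ : Ideal K)) ⟨1, by simp⟩ he hw
    (q := PowerSeries.X ^ d + ofFin (a ∘ P.coeff))
    (fun n => by rw [hfac, sub_self, map_zero]; exact zero_mem _) ⊤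
    (PowerSeries.map a P.arc) fun _ => trivial
  obtain ⟨c, hck, hca, hcv, hcξ⟩ :=
    T.exists_hom (a.comp (algebraMap k A)) (a ∘ P.coeff) v ξ
  refine ⟨c, hφ.comp_eq hck hca ?_⟩
  rw [hcξ, show c ∘ T.coeff = _ from funext hca,
    show c ∘ T.rem = _ from funext hcv, hdiv]

/-- In the fibre `q` is constantly `X ^ d`, and `v + X ^ d ξ` determines `v` and `ξ`. -/
theorem ker_le_map_comap (hφ : IsDivisionComorphism φ P T) (e : B →+* k)
    (he : e.comp (algebraMap k B) = RingHom.id k) (h : ∀ i, e (T.coeff i) = 0) :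
    RingHom.ker e ≤ ((RingHom.ker e).comap φ.toRingHom).map
      φ.toRingHom := by
  refine ArcSpace.ker_le_map_comap φ e (fun C _ c hc => ?_) he
  rw [← RingHom.comp_assoc] at hc
  have ha (i) : c (T.coeff i) = 0 := by
    rw [← hφ.coeff]
    refine (RingHom.congr_fun hc _).trans ?_
    refine (congrArg ((c.comp (algebraMap k B)).comp e) (hφ.coeff i)).trans ?_
    rw [RingHom.comp_apply, h, map_zero]
  have ha' : c ∘ T.coeff = 0 := funext ha
  have h2 : ((c.comp (algebraMap k B)).comp e) ∘ T.coeff = 0 := funext fun i => by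
    rw [Function.comp_apply, RingHom.comp_apply, h, map_zero]
    rfl
  have h1 := congrArg (fun g => PowerSeries.map g P.arc) hc
  simp only [hφ.map_comp_arc, ha', h2, ofFin_zero, add_zero] at h1
  obtain ⟨h3, h4⟩ := eq_of_ofFin_add_X_pow_mul_eq h1
  refine T.hom_ext ?_ (fun i => ?_) (fun i => congrFun h3 i) h4
  · rw [RingHom.comp_assoc, he, RingHom.comp_id]
  · exact (ha i).trans (congrFun h2 i).symm

/-- The stages have as unknowns `v` and the first `n` coefficients of `ξ`. The target is affine, so
there is no open condition and the truncation may start at 0. -/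
theorem isProSmooth (hφ : IsDivisionComorphism φ P T) : IsProSmooth (affineMap k φ).left := by
  let R (n : ℕ) : Empty ⊕ Fin (0 + n) →
      MvPolynomial (Fin d ⊕ Fin (0 + n)) A :=
    divisionEqs (fun i => MvPolynomial.C (P.coeff i))
      (fun i => MvPolynomial.X (Sum.inl i)) (fun i => MvPolynomial.X (Sum.inr i))
      (fun i => MvPolynomial.C (PowerSeries.coeff i P.arc))
  have hR (n : ℕ) {C : Type u} [CommRing C] (a : A →+* C)
      (x : Fin d ⊕ Fin (0 + n) → C) (t) : MvPolynomial.eval₂Hom a x (R n t) =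
      divisionEqs (a ∘ P.coeff) (fun i => x (Sum.inl i)) (fun i => x (Sum.inr i))
        (fun i => a (PowerSeries.coeff i P.arc)) t := by
    refine (map_divisionEqs _ _ _ _ _ _).trans ?_
    congr 1 <;> simp [Function.comp_def]
  refine isProSmooth_of_presentation (CommRingCat.ofHom φ.toRingHom)
    (affineChart k A) (affineMap k φ).left (affineMap_comp_affineChart φ) 0 R (fun n t => ?_)
    (fun n C _ a J _ x hx => ?_) (fun n C _ a x hx => ?_)
    (Sum.elim T.rem fun n => PowerSeries.coeff n T.arc)
    (fun n t => ?_) (fun C _ a x hx => ?_) (fun C _ h h' hh hb => ?_)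
  · have h1 := map_divisionEqs (MvPolynomial.rename (R := A)
      (Sum.map (id : Fin d → _) (Fin.castSucc (n := 0 + n)))).toRingHom
      (N := 0 + n) (fun i => MvPolynomial.C (P.coeff i))
      (fun i => MvPolynomial.X (Sum.inl i)) (fun i => MvPolynomial.X (Sum.inr i))
      (fun i => MvPolynomial.C (PowerSeries.coeff i P.arc)) t
    refine h1.trans (Eq.trans ?_ (divisionEqs_restrict (Nat.le_succ (0 + n)) _ _ _ _ t))
    congr 1 <;> simp [Function.comp_def]
    rfl
  · obtain ⟨v', ξ', hv, hξ, h⟩ := divisionEqs_lift J _ _ _ _ fun t => hR n a x t ▸ hx t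
    refine ⟨Sum.elim v' ξ', ?_, fun t => (hR n a _ t).trans (h t)⟩
    rintro (i | i)
    exacts [hv i, hξ i]
  · rintro p -
    exact ⟨p, rfl⟩
  · refine (hR n _ _ t).trans ?_
    rcases t with t | i
    · exact t.elim
    · refine sub_eq_zero.mpr ((coeff_add_mul_ofFin_coeff _ _ T.arc i.2).trans ?_)
      have h1 := congrArg (PowerSeries.coeff (i : ℕ)) (hφ.arc)
      rw [PowerSeries.coeff_map] at h1
      refine Eq.trans ?_ h1.symm
      congr 4
      exact congrArg ofFin (funext hφ.coeff)
  · have hx' (n t) := (hR n a _ t).symm.trans (hx n t)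
    obtain ⟨c, hck, hca, hcv, hcξ⟩ := T.exists_hom
      (a.comp (algebraMap k A)) (a ∘ P.coeff) (fun i => x (Sum.inl i))
      (PowerSeries.mk fun n => x (Sum.inr n))
    refine ⟨c, hφ.comp_eq hck hca ?_, ?_⟩
    · rw [hcξ, show c ∘ T.coeff = _ from funext hca,
        show c ∘ T.rem = _ from funext hcv]
      ext n
      -- The equation for coefficient `n` first occurs at stage `n + 1`, as stage `n` has only the
      -- indices below `n`.
      have h1 := sub_eq_zero.mp (hx' (n + 1) (Sum.inr ⟨n, by omega⟩))
      have h2 := coeff_add_mul_ofFin_coeff (ofFin fun i => x (Sum.inl i))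
        (PowerSeries.X ^ d + ofFin (a ∘ P.coeff))
        (PowerSeries.mk fun n => x (Sum.inr n)) (N := 0 + (n + 1)) (i := n) (by omega)
      simp only [PowerSeries.coeff_mk] at h2
      rw [← h2, PowerSeries.coeff_map]
      exact h1
    · rintro (i | n)
      · exact hcv i
      · change c (PowerSeries.coeff n T.arc) = x (Sum.inr n)
        rw [← PowerSeries.coeff_map, hcξ, PowerSeries.coeff_mk]
  · refine T.hom_ext ?_ (fun i => ?_) (fun i => hb (Sum.inl i)) ?_
    · rw [← comp_comp_algebraMap φ, ← comp_comp_algebraMap φ h']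
      exact congrArg (fun g => g.comp (algebraMap k A)) hh
    · rw [← hφ.coeff]
      exact RingHom.congr_fun hh _
    · ext n
      exact hb (Sum.inr n)

theorem isWeierstrass (hφ : IsDivisionComorphism φ P T) : IsWeierstrass (affineMap k φ) :=
  isWeierstrass_of_lifts φ _ _ (affineMap_comp_affineChart φ) hφ.isProSmooth fun x =>
    hφ.liftsNilpotentAt _ (evalAt_comp_algebraMap x)

theorem isStrictlyWeierstrassAt (hφ : IsDivisionComorphism φ P T) (x : KPoint (affine k B))
    (hx : ∀ i, evalAt k x (T.coeff i) = 0) : IsStrictlyWeierstrassAt (affineMap k φ) x :=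
  isStrictlyWeierstrassAt_of_lifts φ _ _ (affineMap_comp_affineChart φ) hφ.isProSmooth x
    (hφ.liftsNilpotentAt _ (evalAt_comp_algebraMap x))
    (hφ.ker_le_map_comap _ (evalAt_comp_algebraMap x) hx)

end IsDivisionComorphism

end Division

theorem evalAt_alphaCoeff_eq_zero {k : Type u} [Field k] {d : ℕ}
    (x : KPoint (affine k (AlphaRing k d)))
    (hx : (alphaPoly k d).map (evalAt k x) = Polynomial.X ^ d) (i : Fin d) :
    evalAt k x (alphaCoeff k d i) = 0 := by
  have h1 := congrArg (fun p : k[X] => (p : k⟦X⟧)) hx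
  simp only [coe_map_polynomial, coe_alphaPoly, map_X_pow_add_ofFin, Polynomial.coe_pow,
    Polynomial.coe_X] at h1
  exact congrFun (X_pow_add_ofFin_injective (a' := 0) (by rw [h1, ofFin_zero, add_zero])) i

/-! ### The morphism `β_d` -/

section Beta

variable (k : Type u) [Field k] (d : ℕ)

/-- The universal pair over `Q_d × L A^1`. -/
def betaPair : UniversalPair k d (QRing k d ⊗[k] LA1Ring k) where
  coeff i := (Algebra.TensorProduct.includeLeft : QRing k d →ₐ[k] QRing k d ⊗[k] LA1Ring k)
    (MvPolynomial.X i)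
  arc := PowerSeries.mk fun n =>
    (Algebra.TensorProduct.includeRight : LA1Ring k →ₐ[k] QRing k d ⊗[k] LA1Ring k)
      (MvPolynomial.X n)
  hom_ext {C} _ c c' hk ha hf := by
    let := (c.comp (algebraMap k _)).toAlgebra
    let c₁ : QRing k d ⊗[k] LA1Ring k →ₐ[k] C := { c with commutes' := fun r => rfl }
    let c₂ : QRing k d ⊗[k] LA1Ring k →ₐ[k] C :=
      { c' with commutes' := fun r => (RingHom.congr_fun hk r).symm }
    suffices h : c₁ = c₂ from congrArg AlgHom.toRingHom h
    refine Algebra.TensorProduct.ext (MvPolynomial.algHom_ext ha)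
      (MvPolynomial.algHom_ext fun n => ?_)
    have := congrArg (PowerSeries.coeff n) hf
    rw [PowerSeries.coeff_map, PowerSeries.coeff_map, PowerSeries.coeff_mk] at this
    exact this

/-- The universal triple over `Q_d × A_d × L A^1`. -/
def betaTriple : UniversalTriple k d (BetaRing k d) where
  coeff i := (Algebra.TensorProduct.includeLeft : QRing k d →ₐ[k] BetaRing k d) (MvPolynomial.X i)
  rem i := ((Algebra.TensorProduct.includeRight : ARing k d ⊗[k] LA1Ring k →ₐ[k] BetaRing k d).comp
    (Algebra.TensorProduct.includeLeft : ARing k d →ₐ[k] ARing k d ⊗[k] LA1Ring k))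
      (MvPolynomial.X i)
  arc := betaArc k d
  hom_ext {C} _ c c' hk ha hv hξ := by
    let := (c.comp (algebraMap k (BetaRing k d))).toAlgebra
    let c₁ : BetaRing k d →ₐ[k] C := { c with commutes' := fun r => rfl }
    let c₂ : BetaRing k d →ₐ[k] C :=
      { c' with commutes' := fun r => (RingHom.congr_fun hk r).symm }
    suffices h : c₁ = c₂ from congrArg AlgHom.toRingHom h
    refine Algebra.TensorProduct.ext (MvPolynomial.algHom_ext ha)
      (Algebra.TensorProduct.ext (MvPolynomial.algHom_ext hv)
        (MvPolynomial.algHom_ext fun n => ?_))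
    have := congrArg (PowerSeries.coeff n) hξ
    simp only [betaArc, univArc, PowerSeries.coeff_map, PowerSeries.coeff_mk] at this
    exact this
  exists_hom {C} _ s a v ξ := by
    let := s.toAlgebra
    let c₀ : ARing k d ⊗[k] LA1Ring k →ₐ[k] C :=
      Algebra.TensorProduct.productMap (MvPolynomial.aeval v) (classify ξ)
    let c : BetaRing k d →ₐ[k] C := Algebra.TensorProduct.productMap (MvPolynomial.aeval a) c₀
    have hr (z) : c (Algebra.TensorProduct.includeRight z) = c₀ z :=
      Algebra.TensorProduct.productMap_right_apply _ _ _
    refine ⟨c.toRingHom, c.comp_algebraMap, fun i => ?_, fun i => ?_, ?_⟩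
    · exact (Algebra.TensorProduct.productMap_left_apply _ _ _).trans (MvPolynomial.aeval_X _ _)
    · refine (hr _).trans ?_
      exact (Algebra.TensorProduct.productMap_left_apply _ _ _).trans (MvPolynomial.aeval_X _ _)
    · refine Eq.trans ?_ (map_classify_univArc (k := k) ξ)
      ext n
      simp only [betaArc, PowerSeries.coeff_map]
      exact (hr _).trans (Algebra.TensorProduct.productMap_right_apply _ _ _)

/-- The comorphism of `(q, v, ξ) ↦ (q, v + q ξ)`. -/
def betaComorphism : QRing k d ⊗[k] LA1Ring k →ₐ[k] BetaRing k d :=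
  Algebra.TensorProduct.productMap
    (Algebra.TensorProduct.includeLeft : QRing k d →ₐ[k] BetaRing k d)
    (classify ((betaRem k d : (BetaRing k d)⟦X⟧) +
      (betaPoly k d : (BetaRing k d)⟦X⟧) * betaArc k d))

theorem betaComorphism_includeRight (z : LA1Ring k) :
    betaComorphism k d
        ((Algebra.TensorProduct.includeRight : LA1Ring k →ₐ[k] QRing k d ⊗[k] LA1Ring k) z) =
      classify ((betaRem k d : (BetaRing k d)⟦X⟧) +
        (betaPoly k d : (BetaRing k d)⟦X⟧) * betaArc k d) z :=
  Algebra.TensorProduct.productMap_right_apply _ _ _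

theorem coe_betaPoly : ((betaPoly k d : (BetaRing k d)[X]) : (BetaRing k d)⟦X⟧) =
    PowerSeries.X ^ d + ofFin (betaTriple k d).coeff := by
  rw [betaPoly, coe_map_polynomial (R := QRing k d) (S := BetaRing k d), coe_univMonic,
    map_X_pow_add_ofFin (R := QRing k d) (S := BetaRing k d)]
  rfl

theorem coe_betaRem : ((betaRem k d : (BetaRing k d)[X]) : (BetaRing k d)⟦X⟧) =
    ofFin (betaTriple k d).rem := by
  rw [betaRem, coe_map_polynomial (R := ARing k d) (S := BetaRing k d), coe_univPoly,
    map_ofFin (R := ARing k d) (S := BetaRing k d)]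
  rfl

theorem isDivisionComorphism_betaComorphism :
    IsDivisionComorphism (betaComorphism k d) (betaPair k d) (betaTriple k d) where
  coeff _ := Algebra.TensorProduct.productMap_left_apply _ _ _
  arc := by
    rw [← coe_betaPoly, ← coe_betaRem]
    refine Eq.trans ?_ (map_classify_univArc (k := k) (R := BetaRing k d) _)
    ext n
    have h : PowerSeries.coeff n (betaPair k d).arc =
        (Algebra.TensorProduct.includeRight : LA1Ring k →ₐ[k] QRing k d ⊗[k] LA1Ring k)
          (MvPolynomial.X n) := by
      rw [betaPair, PowerSeries.coeff_mk]
    rw [PowerSeries.coeff_map, PowerSeries.coeff_map, univArc, PowerSeries.coeff_mk, h]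
    exact betaComorphism_includeRight k d _

variable {k d}

theorem evalAt_betaTriple_coeff_eq_zero (x : KPoint (affine k (BetaRing k d)))
    (hx : (betaPoly k d).map (evalAt k x) = Polynomial.X ^ d) (i : Fin d) :
    evalAt k x ((betaTriple k d).coeff i) = 0 := by
  have h1 : (((betaPoly k d).map (evalAt k x) : k[X]) : k⟦X⟧) = PowerSeries.X ^ d := by
    rw [hx, Polynomial.coe_pow, Polynomial.coe_X]
  have h2 := (coe_map_polynomial (evalAt k x) (betaPoly k d)).symm.trans h1
  rw [coe_betaPoly, map_X_pow_add_ofFin] at h2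
  exact congrFun (X_pow_add_ofFin_injective (a' := 0) (by rw [h2, ofFin_zero, add_zero])) i

end Beta

end ArcSpace

end

theorem mainTheorem4 (k : Type u) [Field k] [IsAlgClosed k] (d : ℕ) (hd : 1 ≤ d) :
    (ArcSpace.IsWeierstrass (ArcSpace.alpha k d) ∧
      AlgebraicGeometry.Surjective (ArcSpace.alpha k d).left ∧
      ∀ x : ArcSpace.KPoint (ArcSpace.affine k (ArcSpace.AlphaRing k d)),
        (ArcSpace.alphaPoly k d).map (ArcSpace.evalAt k x) = Polynomial.X ^ d →
          ArcSpace.IsStrictlyWeierstrassAt (ArcSpace.alpha k d) x) ∧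
    (ArcSpace.IsWeierstrass (ArcSpace.beta k d) ∧
      AlgebraicGeometry.Surjective (ArcSpace.beta k d).left ∧
      ∀ x : ArcSpace.KPoint (ArcSpace.affine k (ArcSpace.BetaRing k d)),
        (ArcSpace.betaPoly k d).map (ArcSpace.evalAt k x) = Polynomial.X ^ d →
          ArcSpace.IsStrictlyWeierstrassAt (ArcSpace.beta k d) x) := by
  have hβ := ArcSpace.isDivisionComorphism_betaComorphism k d
  refine ⟨⟨?_, ArcSpace.surjective_alpha k d, fun x hx => ?_⟩, ?_, hβ.surjective, fun x hx => ?_⟩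
  · exact ArcSpace.isWeierstrass_of_lifts _ _ _ (ArcSpace.alpha_comp_arcsLEChart k d)
      (ArcSpace.isProSmooth_alpha k d) fun x =>
        ArcSpace.liftsNilpotentAt_alphaComorphism _ (ArcSpace.evalAt_comp_algebraMap x)
  · have hx' := ArcSpace.evalAt_comp_algebraMap x
    exact ArcSpace.isStrictlyWeierstrassAt_of_lifts _ _ _ (ArcSpace.alpha_comp_arcsLEChart k d)
      (ArcSpace.isProSmooth_alpha k d) x (ArcSpace.liftsNilpotentAt_alphaComorphism _ hx')
      (ArcSpace.ker_le_map_comap_alpha k d _ hx' (ArcSpace.evalAt_alphaCoeff_eq_zero x hx))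
  · exact hβ.isWeierstrass
  · exact hβ.isStrictlyWeierstrassAt x (ArcSpace.evalAt_betaTriple_coeff_eq_zero x hx)
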